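/- Let $d\in\mathbb N$, let $\mathcal C$ be a non-empty finite index set, let $T>0$, let $\Lambda_c\in\mathbb R^{d\times d}$ be symmetric positive definite and let $f_c$ be a probability density on $\mathbb R^d$, for each $c\in\mathcal C$. Put $\Lambda_{\mathcal C}=\bigl(\sum_{c\in\mathcal C}\Lambda_c^{-1}\bigr)^{-1}$ and, for $x=(x^{(c)})_{c\in\mathcal C}$ with $x^{(c)}\in\mathbb R^d$, put $\tilde x=\Lambda_{\mathcal C}\sum_{c\in\mathcal C}\Lambda_c^{-1}x^{(c)}$. On a probability space with probability $\mathbb P$, let $X=(X^{(c)})_{c\in\mathcal C}$ be $\mathbb R^d$-valued processes with continuous paths on $[0,T]$ such that $$\mathrm dX^{(c)}_t=\frac{\tilde X_t-X^{(c)}_t}{T-t}\,\mathrm dt+\Lambda_c^{1/2}\,\mathrm dW^{(c)}_t\quad(0\le t<T),\qquad X^{(c)}_0\sim f_c,$$ where the $W^{(c)}$ are independent standard $d$-dimensional Brownian motions, the initial values $X_0^{(c)}$ are independent, and $(X_0^{(c)})_c$ is independent of $(W^{(c)})_c$. Then: (a) For $0\le s<t<T$, the conditional law of $X_t=(X^{(c)}_t)_{c\in\mathcal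 C}$ given $X_s=x_s$ is the Gaussian law on $\mathbb R^{|\mathcal C|d}$ with mean blocks $$M^{(c)}_{s,t}=\frac{T-t}{T-s}\,x_s^{(c)}+\frac{t-s}{T-s}\,\tilde x_s$$ and positive semi-definite covariance matrix with diagonal blocks $\frac{(t-s)(T-t)}{T-s}\Lambda_{c}+\frac{(t-s)^2}{T-s}\Lambda_{\mathcal C}$, $c\in\mathcal C$, and all off-diagonal blocks equal to $\frac{(t-s)^2}{T-s}\Lambda_{\mathcal C}$. (b) Almost surely all $X^{(c)}_T$, $c\in\mathcal C$, are equal, and for $0\le s<T$ the conditional law of their common value given $X_s=x_s$ is $\mathcal N_d\bigl(\tilde x_s,(T-s)\Lambda_{\mathcal C}\bigr)$. (c) For $c\in\mathcal C$ and $0\le s<t\le T$, the conditional law of the path $(X^{(c)}_q)_{s\le q\le t}$ given $X^{(c)}_s=x_s^{(c)}$ and $X^{(c)}_t=x_t^{(c)}$ is the law of the Brownian bridge with covariance matrix $\Lambda_c$ from $x^{(c)}_s$ at time $s$ to $x^{(c)}_t$ at time $t$, that is, of the continuous Gaussian process with mean $\frac{(t-q)x_s^{(c)}+(q-s)x_t^{(c)}}{t-s}$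 at time $q$ and covariance $\frac{(q-s)(t-r)}{t-s}\Lambda_c$ between the times $q\le r$. In particular, for $s\le q\le t$, the conditional law of $X^{(c)}_q$ is $$\mathcal N_d\Bigl(\frac{(t-q)x_s^{(c)}+(q-s)x_t^{(c)}}{t-s},\ \frac{(t-q)(q-s)}{t-s}\Lambda_c\Bigr).$$ -/

import Mathlib

open MeasureTheory ProbabilityTheory
open scoped NNReal ENNReal MatrixOrder

noncomputable section

/-- The state space `ℝᵈ` with its Euclidean structure. -/
abbrev Vec (d : ℕ) : Type := EuclideanSpace ℝ (Fin d)

/-- The action of a real `d × d` matrix on `ℝᵈ`. -/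
def matAct {d : ℕ} (A : Matrix (Fin d) (Fin d) ℝ) (x : Vec d) : Vec d :=
  Matrix.toEuclideanCLM (𝕜 := ℝ) A x

/-- `Λ_𝒞 = (∑_c Λ_c⁻¹)⁻¹`. -/
def poolCov {d : ℕ} {ι : Type*} [Fintype ι] (Λ : ι → Matrix (Fin d) (Fin d) ℝ) :
    Matrix (Fin d) (Fin d) ℝ :=
  (∑ c, (Λ c)⁻¹)⁻¹

/-- The weighted average `x̃ = (∑_c Λ_c⁻¹)⁻¹ (∑_c Λ_c⁻¹ x⁽ᶜ⁾)`. -/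
def weightedAvg {d : ℕ} {ι : Type*} [Fintype ι] (Λ : ι → Matrix (Fin d) (Fin d) ℝ)
    (x : ι → Vec d) : Vec d :=
  matAct (poolCov Λ) (∑ c, matAct (Λ c)⁻¹ (x c))

/-- `W` is a standard `d`-dimensional Brownian motion: its coordinates are independent standard
real Brownian motions. -/
structure IsBrownianVec {Ω : Type*} [MeasurableSpace Ω] {d : ℕ} (W : ℝ≥0 → Ω → Vec d)
    (P : Measure Ω) : Prop where
  measurable : ∀ r, Measurable (W r)
  isBrownianReal : ∀ i, IsBrownianReal (fun r ω => W r ω i) P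
  iIndepFun_coord : iIndepFun (fun (i : Fin d) (ω : Ω) (r : ℝ≥0) => W r ω i) P

/-- The family `X = (X⁽ᶜ⁾)_c` of continuous processes on `[0, T]`, defined on the probability space
`(Ω, P)`, follows the proposal measure: the initial values `X⁽ᶜ⁾₀` are independent with
densities `f c`, and for independent Brownian motions `W⁽ᶜ⁾`, independent of the initial values,
`dX⁽ᶜ⁾ₜ = (X̃ₜ - X⁽ᶜ⁾ₜ) / (T - t) dt + Λ_c^{1/2} dW⁽ᶜ⁾ₜ`.
As the diffusion coefficient is constant, the equation is the pathwise integral equation on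
`[0, T)`; the value at `T` is determined by continuity of the paths. -/
structure IsProposalProcess {Ω : Type*} [MeasurableSpace Ω] {d : ℕ} {ι : Type*} [Fintype ι]
    (T : ℝ) (Λ : ι → Matrix (Fin d) (Fin d) ℝ) (f : ι → Vec d → ℝ)
    (W : ι → ℝ≥0 → Ω → Vec d) (X : ι → ℝ → Ω → Vec d) (P : Measure Ω) : Prop where
  brownian : ∀ c, IsBrownianVec (W c) P
  iIndepFun_brownian : iIndepFun (fun (c : ι) (ω : Ω) (r : ℝ≥0) => W c r ω) P
  measurable : ∀ c, ∀ t ∈ Set.Icc 0 T, Measurable (X c t)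
  continuousOn : ∀ c ω, ContinuousOn (fun t => X c t ω) (Set.Icc 0 T)
  hasLaw_init : ∀ c, HasLaw (X c 0) (volume.withDensity fun x => ENNReal.ofReal (f c x)) P
  iIndepFun_init : iIndepFun (fun c => X c 0) P
  indepFun_init_brownian :
    IndepFun (fun ω c => X c 0 ω) (fun ω (c : ι) (r : ℝ≥0) => W c r ω) P
  sde : ∀ᵐ ω ∂P, ∀ c, ∀ t ∈ Set.Ico 0 T,
    X c t ω = X c 0 ω
      + (∫ r in (0 : ℝ)..t, (T - r)⁻¹ • (weightedAvg Λ (fun c' => X c' r ω) - X c r ω))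
      + matAct (CFC.sqrt (Λ c)) (W c t.toNNReal ω)

/-- The mean block `M⁽ᶜ⁾_{s,t}` of the transition from the state `x` at time `s`. -/
def transMean {d : ℕ} {ι : Type*} [Fintype ι] (T s t : ℝ)
    (Λ : ι → Matrix (Fin d) (Fin d) ℝ) (x : ι → Vec d) (c : ι) : Vec d :=
  ((T - t) / (T - s)) • x c + ((t - s) / (T - s)) • weightedAvg Λ x

/-- The block `Γ_{cc'}` of the transition covariance from time `s` to time `t`. -/
def transCovBlock {d : ℕ} {ι : Type*} [Fintype ι] [DecidableEq ι] (T s t : ℝ)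
    (Λ : ι → Matrix (Fin d) (Fin d) ℝ) (c c' : ι) : Matrix (Fin d) (Fin d) ℝ :=
  if c = c' then
    ((t - s) * (T - t) / (T - s)) • Λ c + ((t - s) ^ 2 / (T - s)) • poolCov Λ
  else
    ((t - s) ^ 2 / (T - s)) • poolCov Λ

/-- The transition covariance `V_{s,t}`, a `|𝒞|d × |𝒞|d` matrix. -/
def transCov {d : ℕ} {ι : Type*} [Fintype ι] [DecidableEq ι] (T s t : ℝ)
    (Λ : ι → Matrix (Fin d) (Fin d) ℝ) : Matrix (ι × Fin d) (ι × Fin d) ℝ :=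
  Matrix.of fun p q => transCovBlock T s t Λ p.1 q.1 p.2 q.2

/-- Concatenation of `|𝒞|` vectors of `ℝᵈ` into one vector of `ℝ^{|𝒞|d}`. -/
def stack {d : ℕ} {ι : Type*} (x : ι → Vec d) : EuclideanSpace ℝ (ι × Fin d) :=
  WithLp.toLp 2 fun p => x p.1 p.2

/-- Under `P`, the conditional law of `Y` given `X = x` is `F x`: the measures `F x` form a kernel
that is a regular conditional distribution of `Y` given `X`. -/
def HasCondLaw {Ω α β : Type*} [MeasurableSpace Ω] [MeasurableSpace α] [MeasurableSpace β]
    (Y : Ω → β) (X : Ω → α) (F : α → Measure β) (P : Measure Ω) : Prop :=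
  ∃ κ : Kernel α β, (∀ x, κ x = F x) ∧ HasCondDistrib Y X κ P

/-- Continuous paths `[s, t] → ℝᵈ`. -/
abbrev PathSpace (d : ℕ) (s t : ℝ) : Type := C(Set.Icc s t, Vec d)

/-- The path space carries the σ-algebra generated by the evaluations. -/
instance pathMeasurableSpace (d : ℕ) (s t : ℝ) : MeasurableSpace (PathSpace d s t) :=
  MeasurableSpace.comap (fun (w : PathSpace d s t) (q : Set.Icc s t) => w q) MeasurableSpace.pi

/-- The restriction to `[s, t]` of a path that is continuous on `[0, T]`. -/
def restrictPath {d : ℕ} {T s t : ℝ} (x : ℝ → Vec d) (hx : ContinuousOn x (Set.Icc 0 T))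
    (hs : 0 ≤ s) (ht : t ≤ T) : PathSpace d s t where
  toFun q := x q
  continuous_toFun := (hx.mono (Set.Icc_subset_Icc hs ht)).domRestrict

/-- `Q` is the law on continuous paths of the Brownian bridge with covariance matrix `Λ` from `x` at
time `s` to `y` at time `t`: the coordinate process is Gaussian with the bridge mean and
covariance functions. -/
structure IsBrownianBridgeLaw {d : ℕ} (Λ : Matrix (Fin d) (Fin d) ℝ) (s t : ℝ) (x y : Vec d)
    (Q : Measure (PathSpace d s t)) : Prop where
  isProbabilityMeasure : IsProbabilityMeasure Q
  isGaussianProcess :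
    IsGaussianProcess (fun (q : Set.Icc s t) (w : PathSpace d s t) => w q) Q
  mean : ∀ q : Set.Icc s t,
    ∫ w, w q ∂Q = ((t - q) / (t - s)) • x + ((q - s) / (t - s)) • y
  covariance : ∀ q r : Set.Icc s t, q ≤ r → ∀ i j : Fin d,
    cov[fun w : PathSpace d s t => w q i, fun w : PathSpace d s t => w r j; Q]
      = (q - s) * (t - r) / (t - s) * Λ i j

end

/-! Write `g_c = Λ_c^{1/2} W⁽ᶜ⁾` and let a tilde denote the weighted average. The weights `Λ_𝒞
Λ_c⁻¹` sum to the identity, so the drift cancels in the average: `X̃_t = X̃_0 + g̃_t`, where `g̃` is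
a Brownian motion with covariance `Λ_𝒞`. The scaled deviation `E = (X⁽ᶜ⁾ - X̃) / (T - t)` has no
drift either: `dE = (T - t)⁻¹ d(g_c - g̃)`. The integrand is deterministic and `E` is continuous, so
`E_t - E_0` is a pathwise limit of Riemann sums and no stochastic integral is needed
(`tendsto_riemannSum`, `tendsto_noiseApprox`).

Hence `X⁽ᶜ⁾_t` is a linear function of `X_0` plus a limit of linear functions of the Brownian
motions. Since `g̃` is uncorrelated with every `g_c - g̃`, and `(T - s)(T - t) ∫_0^s (T - r)⁻² dr =
s - st/T` for `s ≤ t`, the noises of `c` at `s` and of `c'` at `t` have covariance `min(s,t) Λ_𝒞 +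
(min(s,t) - st/T)(δ_{cc'} Λ_c - Λ_𝒞)` (`hasCrossCov_processNoise`). Almost sure limits of centered
Gaussians are Gaussian with converging variances (`hasGaussianLaw_of_tendsto_ae`), so all noise lies
in one Gaussian space, generated by the Brownian motions and therefore independent of `X_0`.

The rest is Gaussian regression. In each case the candidate conditional mean is subtracted. The
initial value, which need not be Gaussian, drops out of the residual, and the residual is
uncorrelated with the noise at the conditioning times, hence independent of it jointly with `X_0`
(`indepFun_prodMk_of_hasCrossCov_zero`). The conditional law is then a translate of the law of the
residual (`exists_hasCondDistrib_of_indepFun`). At time `T` the factor `min(s,t) - st/T` vanishes,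
so the components coincide. For a single component the term in `st` is annihilated by interpolation
between two times, which leaves the Brownian covariance `min(s,t) Λ_c` and hence the Brownian
bridge. -/

noncomputable section

open Filter Topology RealInnerProductSpace

/-! ### Almost sure limits of centered Gaussian variables -/

section GaussianLimit

variable {Ω : Type*} [mΩ : MeasurableSpace Ω] {P : Measure Ω}

lemma charFun_map_of_hasGaussianLaw_of_integral_eq_zero {Y : Ω → ℝ} (hY : HasGaussianLaw Y P)
    (hY0 : ∫ ω, Y ω ∂P = 0) (t : ℝ) :
    charFun (P.map Y) t = ((Real.exp (-(Var[Y; P] * t ^ 2 / 2)) : ℝ) : ℂ) := by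
  rw [hY.map_eq_gaussianReal, charFun_gaussianReal, hY0, Real.coe_toNNReal _ (variance_nonneg _ _)]
  push_cast
  congr 1
  simp

lemma tendsto_charFun_map [IsProbabilityMeasure P] {y : ℕ → Ω → ℝ} {Y : Ω → ℝ}
    (hy : ∀ n, AEMeasurable (y n) P) (hY : AEMeasurable Y P)
    (hlim : ∀ᵐ ω ∂P, Tendsto (fun n => y n ω) atTop (𝓝 (Y ω))) (t : ℝ) :
    Tendsto (fun n => charFun (P.map (y n)) t) atTop (𝓝 (charFun (P.map Y) t)) := by
  have key : ∀ Z : Ω → ℝ, AEMeasurable Z P →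
      charFun (P.map Z) t = ∫ ω, Complex.exp (t * Z ω * Complex.I) ∂P := fun Z hZ => by
    rw [charFun_apply_real, integral_map hZ (by fun_prop)]
  rw [key Y hY]
  simp_rw [fun n => key (y n) (hy n)]
  refine tendsto_integral_of_dominated_convergence (fun _ => 1) ?_ (integrable_const _) ?_ ?_
  · intro n
    exact Measurable.aestronglyMeasurable (f := fun x : ℝ => Complex.exp (t * x * Complex.I))
      (by fun_prop) |>.comp_aemeasurable (hy n)
  · intro n
    refine ae_of_all _ fun ω => ?_
    rw [← Complex.ofReal_mul, Complex.norm_exp_ofReal_mul_I]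
  · filter_upwards [hlim] with ω hω
    have : Continuous fun x : ℝ => Complex.exp (t * x * Complex.I) := by fun_prop
    exact (this.tendsto _).comp hω

/-- An almost sure limit of centered real Gaussian variables is a centered Gaussian variable, and
the variances converge. -/
lemma hasGaussianLaw_of_tendsto_ae [IsProbabilityMeasure P] {y : ℕ → Ω → ℝ} {Y : Ω → ℝ}
    (hy : ∀ n, HasGaussianLaw (y n) P) (hy0 : ∀ n, ∫ ω, y n ω ∂P = 0)
    (hlim : ∀ᵐ ω ∂P, Tendsto (fun n => y n ω) atTop (𝓝 (Y ω))) :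
    HasGaussianLaw Y P ∧ ∫ ω, Y ω ∂P = 0 ∧
      Tendsto (fun n => Var[y n; P]) atTop (𝓝 Var[Y; P]) := by
  have hYm : AEMeasurable Y P :=
    aemeasurable_of_tendsto_metrizable_ae _ (fun n => (hy n).aemeasurable) hlim
  have hprob : IsProbabilityMeasure (P.map Y) := Measure.isProbabilityMeasure_map hYm
  have hconv := tendsto_charFun_map (fun n => (hy n).aemeasurable) hYm hlim
  simp_rw [fun n => charFun_map_of_hasGaussianLaw_of_integral_eq_zero (hy n) (hy0 n)] at hconv
  have hre : ∀ t, Tendsto (fun n => Real.exp (-(Var[y n; P] * t ^ 2 / 2))) atTop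
      (𝓝 (charFun (P.map Y) t).re) := fun t => by
    simpa [Function.comp_def, -Complex.ofReal_exp] using (Complex.continuous_re.tendsto _).comp (hconv t)
  -- The limiting characteristic function is continuous with value 1 at 0, so its real part is
  -- positive at some `t ≠ 0`. Taking logarithms there shows that the variances converge, with no a
  -- priori bound on them.
  obtain ⟨t, ht, htpos⟩ : ∃ t : ℝ, t ≠ 0 ∧ 0 < (charFun (P.map Y) t).re := by
    have hc : Continuous fun t => (charFun (P.map Y) t).re :=
      Complex.continuous_re.comp continuous_charFun
    have h0 : 0 < (charFun (P.map Y) 0).re := by simp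
    have hev : ∀ᶠ t in 𝓝[≠] (0 : ℝ), 0 < (charFun (P.map Y) t).re :=
      (hc.tendsto 0).eventually (lt_mem_nhds h0) |>.filter_mono nhdsWithin_le_nhds
    obtain ⟨t, h1, h2⟩ := (hev.and self_mem_nhdsWithin).exists
    exact ⟨t, h2, h1⟩
  obtain ⟨v, hv⟩ : ∃ v, Tendsto (fun n => Var[y n; P]) atTop (𝓝 v) := by
    refine ⟨-(Real.log (charFun (P.map Y) t).re) * 2 / t ^ 2, ?_⟩
    have h := (Real.continuousAt_log htpos.ne').tendsto.comp (hre t)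
    refine ((h.neg.mul_const 2).div_const (t ^ 2)).congr fun n => ?_
    simp only [Function.comp, Real.log_exp]
    field_simp
  have hv0 : 0 ≤ v := ge_of_tendsto' hv fun n => variance_nonneg _ _
  have hlaw : P.map Y = gaussianReal 0 v.toNNReal := by
    refine Measure.ext_of_charFun (funext fun t => ?_)
    refine tendsto_nhds_unique (hconv t) ?_
    have h1 : Tendsto (fun n => Real.exp (-(Var[y n; P] * t ^ 2 / 2))) atTop
        (𝓝 (Real.exp (-(v * t ^ 2 / 2)))) :=
      (Real.continuous_exp.tendsto _).comp (((hv.mul_const (t ^ 2)).div_const 2).neg)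
    have h2 := (Complex.continuous_ofReal.tendsto _).comp h1
    convert! h2 using 2
    rw [charFun_gaussianReal, Real.coe_toNNReal _ hv0]
    push_cast
    congr 1
    simp
  have hY : HasLaw Y (gaussianReal 0 v.toNNReal) P := ⟨hYm, hlaw⟩
  refine ⟨hY.hasGaussianLaw, ?_, ?_⟩
  · rw [hY.integral_eq, integral_id_gaussianReal]
  · rw [hY.variance_eq, variance_id_gaussianReal, Real.coe_toNNReal _ hv0]
    exact hv

end GaussianLimit

/-! ### Gaussian spaces and their closure under almost sure limits -/

section GaussianSpace

variable {Ω : Type*} {m : MeasurableSpace Ω} [mΩ : MeasurableSpace Ω] {P : Measure Ω}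
  {S : Submodule ℝ (Ω → ℝ)}

/-- A Gaussian space: a vector space of centered Gaussian random variables, each of them a
modification of an `m`-measurable random variable. -/
structure IsGaussianSpace (m : MeasurableSpace Ω) (S : Submodule ℝ (Ω → ℝ))
    (P : Measure[mΩ] Ω) : Prop where
  hasGaussianLaw : ∀ Y ∈ S, HasGaussianLaw Y P
  integral_eq_zero : ∀ Y ∈ S, ∫ ω, Y ω ∂P = 0
  exists_measurable : ∀ Y ∈ S, ∃ Y', Measurable[m] Y' ∧ Y =ᵐ[P] Y'

/-- The random variables that are almost sure limits of sequences in `S`. -/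
def aeSeqClosure (S : Submodule ℝ (Ω → ℝ)) (P : Measure Ω) : Submodule ℝ (Ω → ℝ) where
  carrier := {Y | ∃ y : ℕ → Ω → ℝ, (∀ n, y n ∈ S) ∧
    ∀ᵐ ω ∂P, Tendsto (fun n => y n ω) atTop (𝓝 (Y ω))}
  add_mem' := by
    rintro X Y ⟨x, hx, hxX⟩ ⟨y, hy, hyY⟩
    refine ⟨fun n => x n + y n, fun n => S.add_mem (hx n) (hy n), ?_⟩
    filter_upwards [hxX, hyY] with ω h1 h2 using h1.add h2
  zero_mem' := ⟨fun _ => 0, fun _ => S.zero_mem, by simp⟩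
  smul_mem' := by
    rintro c Y ⟨y, hy, hyY⟩
    refine ⟨fun n => c • y n, fun n => S.smul_mem c (hy n), ?_⟩
    filter_upwards [hyY] with ω h using h.const_smul c

lemma mem_aeSeqClosure {Y : Ω → ℝ} {y : ℕ → Ω → ℝ} (hy : ∀ n, y n ∈ S)
    (hlim : ∀ᵐ ω ∂P, Tendsto (fun n => y n ω) atTop (𝓝 (Y ω))) : Y ∈ aeSeqClosure S P :=
  ⟨y, hy, hlim⟩

namespace IsGaussianSpace

lemma aeSeqClosure [IsProbabilityMeasure P] (hS : IsGaussianSpace m S P) :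
    IsGaussianSpace m (aeSeqClosure S P) P where
  hasGaussianLaw := by
    rintro Y ⟨y, hy, hlim⟩
    exact (hasGaussianLaw_of_tendsto_ae (fun n => hS.hasGaussianLaw _ (hy n))
      (fun n => hS.integral_eq_zero _ (hy n)) hlim).1
  integral_eq_zero := by
    rintro Y ⟨y, hy, hlim⟩
    exact (hasGaussianLaw_of_tendsto_ae (fun n => hS.hasGaussianLaw _ (hy n))
      (fun n => hS.integral_eq_zero _ (hy n)) hlim).2.1
  exists_measurable := by
    rintro Y ⟨y, hy, hlim⟩
    choose y' hy' hyy' using fun n => hS.exists_measurable _ (hy n)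
    -- The limit exists only off a null set; the limsup is an `m`-measurable version defined
    -- everywhere.
    refine ⟨fun ω => limsup (fun n => y' n ω) atTop, Measurable.limsup hy', ?_⟩
    filter_upwards [hlim, ae_all_iff.2 hyy'] with ω h1 h2
    simp_rw [h2] at h1
    exact h1.limsup_eq.symm

lemma memLp_two (hS : IsGaussianSpace m S P) {Y : Ω → ℝ} (hY : Y ∈ S) : MemLp Y 2 P :=
  (hS.hasGaussianLaw Y hY).memLp_two

/-- Polarization: the limit theorem only controls variances, and this transfers it to covariances.
-/
lemma covariance_eq_variance [IsProbabilityMeasure P] (hS : IsGaussianSpace m S P) {X Y : Ω → ℝ}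
    (hX : X ∈ S) (hY : Y ∈ S) :
    cov[X, Y; P] = (Var[X + Y; P] - Var[X; P] - Var[Y; P]) / 2 := by
  rw [variance_add (hS.memLp_two hX) (hS.memLp_two hY)]
  ring

lemma tendsto_covariance [IsProbabilityMeasure P] (hS : IsGaussianSpace m S P)
    {x y : ℕ → Ω → ℝ} {X Y : Ω → ℝ} (hx : ∀ n, x n ∈ S) (hy : ∀ n, y n ∈ S)
    (hxX : ∀ᵐ ω ∂P, Tendsto (fun n => x n ω) atTop (𝓝 (X ω)))
    (hyY : ∀ᵐ ω ∂P, Tendsto (fun n => y n ω) atTop (𝓝 (Y ω))) :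
    Tendsto (fun n => cov[x n, y n; P]) atTop (𝓝 cov[X, Y; P]) := by
  have hX := mem_aeSeqClosure hx hxX
  have hY := mem_aeSeqClosure hy hyY
  have key : ∀ {z : ℕ → Ω → ℝ} {Z : Ω → ℝ}, (∀ n, z n ∈ S) →
      (∀ᵐ ω ∂P, Tendsto (fun n => z n ω) atTop (𝓝 (Z ω))) →
      Tendsto (fun n => Var[z n; P]) atTop (𝓝 Var[Z; P]) := fun hz hzZ =>
    (hasGaussianLaw_of_tendsto_ae (fun n => hS.hasGaussianLaw _ (hz n))
      (fun n => hS.integral_eq_zero _ (hz n)) hzZ).2.2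
  rw [hS.aeSeqClosure.covariance_eq_variance hX hY]
  simp_rw [fun n => hS.covariance_eq_variance (hx n) (hy n)]
  refine (((key (z := fun n => x n + y n) (fun n => S.add_mem (hx n) (hy n)) ?_).sub
    (key hx hxX)).sub (key hy hyY)).div_const 2
  filter_upwards [hxX, hyY] with ω h1 h2 using h1.add h2

variable {κ : Type*} [Fintype κ]

/-- A family of Euclidean vectors with coordinates in a Gaussian space is a Gaussian process. -/
lemma isGaussianProcess (hS : IsGaussianSpace m S P) {I : Type*}
    {Y : I → Ω → EuclideanSpace ℝ κ} (hY : ∀ i u, (fun ω => ⟪u, Y i ω⟫) ∈ S) :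
    IsGaussianProcess Y P where
  hasGaussianLaw J := by
    classical
    have hcoord : ∀ i k, AEMeasurable (fun ω => Y i ω k) P := fun i k => by
      simpa [PiLp.inner_apply, PiLp.single_apply] using
        (hS.hasGaussianLaw _ (hY i (EuclideanSpace.single k 1))).aemeasurable
    have hYm : ∀ i, AEMeasurable (Y i) P := fun i =>
      (MeasurableEquiv.toLp 2 (κ → ℝ)).measurable.comp_aemeasurable
        (aemeasurable_pi_lambda _ (hcoord i))
    have hm : AEMeasurable (fun ω => J.restrict (Y · ω)) P :=
      aemeasurable_pi_lambda _ fun i => hYm i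
    refine ⟨⟨fun L => ?_⟩⟩
    -- By Riesz representation on each factor, a continuous functional of finitely many of the
    -- vectors is a sum of inner products with fixed vectors.
    have hL : L ∘ (fun ω => J.restrict (Y · ω)) ∈ S := by
      have : L ∘ (fun ω => J.restrict (Y · ω)) = ∑ i : J, fun ω =>
          ⟪(InnerProductSpace.toDual ℝ (EuclideanSpace ℝ κ)).symm
            (L ∘L ContinuousLinearMap.single ℝ (fun _ : J => EuclideanSpace ℝ κ) i), Y i ω⟫ := by
        ext ω
        simp only [Function.comp, Finset.sum_apply, InnerProductSpace.toDual_symm_apply,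
          ContinuousLinearMap.comp_apply]
        rw [← map_sum]
        congr 1
        ext1 i
        simp [ContinuousLinearMap.single_apply, Finset.sum_apply, Pi.single_apply,
          Finset.sum_ite_eq]
      rw [this]
      exact S.sum_mem fun i _ => hY _ _
    have h := (hS.hasGaussianLaw _ hL).isGaussian_map
    rw [AEMeasurable.map_map_of_aemeasurable (by fun_prop) hm,
      (hS.hasGaussianLaw _ hL).map_eq_gaussianReal, integral_map hm (by fun_prop),
      variance_map (by fun_prop) hm]
    rfl

/-- A random vector with coordinates in a Gaussian space has the multivariate Gaussian law given by
its covariances. -/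
lemma hasLaw_multivariateGaussian [IsProbabilityMeasure P] (hS : IsGaussianSpace m S P)
    [DecidableEq κ]
    {Y : Ω → EuclideanSpace ℝ κ} (hYm : AEMeasurable Y P) (hY : ∀ u, (fun ω => ⟪u, Y ω⟫) ∈ S)
    {V : Matrix κ κ ℝ}
    (hV : ∀ i j, cov[fun ω => Y ω i, fun ω => Y ω j; P] = V i j) :
    V.PosSemidef ∧ HasLaw Y (multivariateGaussian 0 V) P := by
  have hcoord : ∀ i, (fun ω => Y ω i) ∈ S := fun i => by
    simpa [PiLp.inner_apply, PiLp.single_apply] using hY (EuclideanSpace.single i 1)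
  have hvar : ∀ u : EuclideanSpace ℝ κ, Var[fun ω => ⟪u, Y ω⟫; P] = u ⬝ᵥ V.mulVec u := fun u => by
    have : (fun ω => ⟪u, Y ω⟫) = fun ω => ∑ i, u i * Y ω i := by
      ext ω; simp [PiLp.inner_apply, mul_comm]
    rw [this, ← covariance_self (by simpa [this] using (hS.memLp_two (hY u)).aemeasurable),
      covariance_fun_sum_fun_sum (fun i => (hS.memLp_two (hcoord i)).const_mul _)
      (fun i => (hS.memLp_two (hcoord i)).const_mul _)]
    simp_rw [covariance_const_mul_left, covariance_const_mul_right, hV]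
    simp only [dotProduct, Matrix.mulVec, Finset.mul_sum]
    exact Finset.sum_congr rfl fun i _ => Finset.sum_congr rfl fun j _ => by ring
  -- Positive semidefiniteness is not assumed: the quadratic form of `V` is a variance.
  have hPSD : V.PosSemidef := by
    refine Matrix.PosSemidef.of_dotProduct_mulVec_nonneg ?_ fun x => ?_
    · ext i j
      simp only [Matrix.conjTranspose_apply, star_trivial, ← hV]
      exact covariance_comm _ _
    · have := hvar (WithLp.toLp 2 x)
      simp only [star_trivial]
      rw [← this]
      exact variance_nonneg _ _
  refine ⟨hPSD, hYm, ?_⟩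
  have := Measure.isProbabilityMeasure_map hYm
  refine Measure.ext_of_charFun (funext fun u => ?_)
  rw [charFun_multivariateGaussian hPSD, ← hvar]
  have h1 : charFun (P.map Y) u = charFun (P.map fun ω => ⟪u, Y ω⟫) 1 := by
    rw [charFun_apply, charFun_apply_real, integral_map hYm (by fun_prop),
      integral_map (hS.memLp_two (hY u)).aemeasurable (by fun_prop)]
    simp [real_inner_comm]
  rw [h1, charFun_map_of_hasGaussianLaw_of_integral_eq_zero (hS.hasGaussianLaw _ (hY u))
    (hS.integral_eq_zero _ (hY u))]
  simp

/-- A family of Euclidean vectors with coordinates in a Gaussian space adapted to `m` is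
independent of every random variable that is independent of `m`. -/
lemma indepFun_process [IsProbabilityMeasure P] (hS : IsGaussianSpace m S P) {I β : Type*}
    [MeasurableSpace β] {V : Ω → β}
    {Y : I → Ω → EuclideanSpace ℝ κ} (hY : ∀ i u, (fun ω => ⟪u, Y i ω⟫) ∈ S)
    (hV : Indep (MeasurableSpace.comap V inferInstance) m P) :
    IndepFun V (fun ω i => Y i ω) P := by
  classical
  have hcoord : ∀ i k, (fun ω => Y i ω k) ∈ S := fun i k => by
    simpa [PiLp.inner_apply, PiLp.single_apply] using hY i (EuclideanSpace.single k 1)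
  choose y hy hYy using fun i k => hS.exists_measurable _ (hcoord i k)
  have h1 : IndepFun V (fun ω i => WithLp.toLp 2 fun k => y i k ω) P := by
    rw [IndepFun_iff_Indep]
    refine indep_of_indep_of_le_right hV (Measurable.comap_le ?_)
    exact @measurable_pi_lambda _ _ _ m _ _ fun i =>
      (MeasurableEquiv.toLp 2 (κ → ℝ)).measurable.comp (@measurable_pi_lambda _ _ _ m _ _ (hy i))
  -- The index set may be uncountable, so the modifications need not agree simultaneously; agreement
  -- at each index suffices for the product σ-algebra.
  refine h1.process_congr_right fun i => ?_
  filter_upwards [ae_all_iff.2 (hYy i)] with ω hω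
  ext k
  exact (hω k).symm

/-- Membership in one common Gaussian space makes the two families jointly Gaussian, which is what
turns zero covariance into independence. -/
lemma indepFun_of_covariance_inner (hS : IsGaussianSpace m S P) {I J : Type*}
    {Y : I → Ω → EuclideanSpace ℝ κ} {Z : J → Ω → EuclideanSpace ℝ κ}
    (hY : ∀ i u, (fun ω => ⟪u, Y i ω⟫) ∈ S) (hZ : ∀ j u, (fun ω => ⟪u, Z j ω⟫) ∈ S)
    (hcov : ∀ i j u v, cov[fun ω => ⟪u, Y i ω⟫, fun ω => ⟪v, Z j ω⟫; P] = 0) :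
    IndepFun (fun ω i => Y i ω) (fun ω j => Z j ω) P := by
  have h : IsGaussianProcess (Sum.elim Y Z) P :=
    hS.isGaussianProcess fun i u => by rcases i with i | j; exacts [hY i u, hZ j u]
  exact h.indepFun_of_covariance_inner (fun i => h.aemeasurable (Sum.inl i))
    (fun j => h.aemeasurable (Sum.inr j)) hcov

end IsGaussianSpace

end GaussianSpace

/-! ### Independence of triples and disintegration of a function of independent variables -/

section Independence

variable {Ω α β γ : Type*} [MeasurableSpace Ω] [MeasurableSpace α] [MeasurableSpace β]
  [MeasurableSpace γ] {P : Measure Ω} {U : Ω → α} {V : Ω → β} {R : Ω → γ}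

/-- If `U` is independent of `(V, R)` and `V` is independent of `R`, then `(U, V)` is independent
of `R`. -/
lemma indepFun_prodMk_of_indepFun [IsProbabilityMeasure P] (hU : AEMeasurable U P)
    (hV : AEMeasurable V P) (hR : AEMeasurable R P)
    (h1 : IndepFun U (fun ω => (V ω, R ω)) P) (h2 : IndepFun V R P) :
    IndepFun (fun ω => (U ω, V ω)) R P := by
  have := Measure.isProbabilityMeasure_map hU
  have := Measure.isProbabilityMeasure_map hV
  have := Measure.isProbabilityMeasure_map hR
  have hUV : IndepFun U V P := h1.comp measurable_id measurable_fst
  rw [indepFun_iff_map_prod_eq_prod_map_map (hU.prodMk hV) hR,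
    (indepFun_iff_map_prod_eq_prod_map_map hU hV).1 hUV]
  rw [indepFun_iff_map_prod_eq_prod_map_map hU (hV.prodMk hR),
    (indepFun_iff_map_prod_eq_prod_map_map hV hR).1 h2] at h1
  have : (P.map fun ω => ((U ω, V ω), R ω)) =
      (P.map fun ω => (U ω, V ω, R ω)).map MeasurableEquiv.prodAssoc.symm := by
    rw [AEMeasurable.map_map_of_aemeasurable (by fun_prop) (by fun_prop)]
    rfl
  rw [this, h1, ← Measure.prodAssoc_prod, Measure.map_map (by fun_prop) (by fun_prop)]
  simp

/-- The conditional law of `g (X, R)` given `X`, for `R` independent of `X`. -/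
lemma exists_hasCondDistrib_of_indepFun [IsProbabilityMeasure P] {X : Ω → α} {Y : Ω → β}
    {g : α → γ → β} (hX : AEMeasurable X P) (hR : AEMeasurable R P) (hXR : IndepFun X R P)
    (hg : Measurable (Function.uncurry g)) (hY : ∀ᵐ ω ∂P, Y ω = g (X ω) (R ω)) :
    ∃ κ : Kernel α β, (∀ x, κ x = (P.map R).map (g x)) ∧ HasCondDistrib Y X κ P := by
  have := Measure.isProbabilityMeasure_map hX
  have := Measure.isProbabilityMeasure_map hR
  let κ : Kernel α β := (Kernel.id ×ₖ Kernel.const α (P.map R)).map (Function.uncurry g)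
  have hκ : ∀ x, κ x = (P.map R).map (g x) := fun x => by
    rw [Kernel.map_apply _ hg, Kernel.prod_apply, Kernel.id_apply, Kernel.const_apply,
      Measure.dirac_prod, Measure.map_map hg (by fun_prop)]
    rfl
  have hκM : IsMarkovKernel κ := Kernel.IsMarkovKernel.map _ hg
  have hXY : (fun ω => (X ω, g (X ω) (R ω))) =ᵐ[P] fun ω => (X ω, Y ω) := by
    filter_upwards [hY] with ω hω
    rw [hω]
  have hgX : AEMeasurable (fun ω => g (X ω) (R ω)) P := hg.comp_aemeasurable (hX.prodMk hR)
  refine ⟨κ, hκ, (hX.prodMk hgX).congr hXY, ?_⟩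
  have hmeas : Measurable fun p : α × γ => (p.1, g p.1 p.2) := measurable_fst.prodMk hg
  rw [← Measure.map_congr hXY, show (fun ω => (X ω, g (X ω) (R ω))) =
      (fun p : α × γ => (p.1, g p.1 p.2)) ∘ fun ω => (X ω, R ω) from rfl,
    ← AEMeasurable.map_map_of_aemeasurable hmeas.aemeasurable (hX.prodMk hR),
    (indepFun_iff_map_prod_eq_prod_map_map hX hR).1 hXR]
  ext s hs
  rw [Measure.map_apply hmeas hs, Measure.prod_apply (hmeas hs), Measure.compProd_apply hs]
  refine lintegral_congr fun x => ?_
  rw [hκ, Measure.map_apply (hg.of_uncurry_left (x := x)) (measurable_prodMk_left hs)]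
  rfl

end Independence

/-! ### Riemann sums on a stopped uniform grid -/

section Grid

/-- The points of the uniform grid of `[0, T]`, stopped at `t`. -/
def gridPoint (T t : ℝ) (n k : ℕ) : ℝ := min (T * k / n) t

variable {T t : ℝ} {n k : ℕ}

lemma gridPoint_zero (ht : 0 ≤ t) : gridPoint T t n 0 = 0 := by simp [gridPoint, ht]

lemma gridPoint_self (ht : t ≤ T) (hn : n ≠ 0) : gridPoint T t n n = t := by
  have : (n : ℝ) ≠ 0 := by exact_mod_cast hn
  simp [gridPoint, this, ht]

lemma gridPoint_le : gridPoint T t n k ≤ t := min_le_right _ _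

lemma gridPoint_nonneg (hT : 0 ≤ T) (ht : 0 ≤ t) : 0 ≤ gridPoint T t n k :=
  le_min (by positivity) ht

lemma gridPoint_mono (hT : 0 ≤ T) : Monotone (gridPoint T t n) := fun k l hkl =>
  min_le_min_right _ (by gcongr)

lemma gridPoint_succ_sub_le (hT : 0 ≤ T) :
    gridPoint T t n (k + 1) - gridPoint T t n k ≤ T / n := by
  have h : T * (k + 1 : ℕ) / n = T * k / n + T / n := by push_cast; ring
  have h0 : 0 ≤ T / n := by positivity
  unfold gridPoint
  rw [h]
  rcases le_total (T * k / n) t with h1 | h1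
  · rw [min_eq_left h1]
    linarith [min_le_left (T * k / n + T / n) t]
  · rw [min_eq_right h1]
    linarith [min_le_right (T * k / n + T / n) t]

/-- Either the grid point is before the stopping time, or nothing happens any more. -/
lemma gridPoint_cases (hT : 0 ≤ T) (k : ℕ) :
    (gridPoint T t n k = T * k / n) ∨ (gridPoint T t n k = t ∧ gridPoint T t n (k + 1) = t) := by
  rcases le_total (T * k / n) t with h1 | h1
  · exact Or.inl (min_eq_left h1)
  · refine Or.inr ⟨min_eq_right h1, min_eq_right (h1.trans ?_)⟩
    gcongr
    simp

variable {V : Type*} [NormedAddCommGroup V] [NormedSpace ℝ V]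

/-- The left-point Riemann sums of `∫_0^t (T - r)⁻¹ dN_r`. -/
def riemannSum (T t : ℝ) (N : ℝ → V) (n : ℕ) : V :=
  ∑ k ∈ Finset.range n,
    (T - T * k / n)⁻¹ • (N (gridPoint T t n (k + 1)) - N (gridPoint T t n k))

/-- The Euler scheme of the linear equation `d((T - r) E_r) = -E_r dr + dN_r`. -/
lemma tendsto_riemannSum [CompleteSpace V] (hT : 0 < T) (ht0 : 0 ≤ t) (htT : t < T) {E N : ℝ → V}
    (hE : ContinuousOn E (Set.Icc 0 t))
    (h : ∀ r ∈ Set.Icc 0 t, (T - r) • E r = T • E 0 - (∫ u in (0 : ℝ)..r, E u) + N r) :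
    Tendsto (riemannSum T t N) atTop (𝓝 (E t - E 0)) := by
  have hTt : 0 < T - t := sub_pos.2 htT
  have huc : UniformContinuousOn E (Set.Icc 0 t) :=
    isCompact_Icc.uniformContinuousOn_of_continuous hE
  rw [Metric.tendsto_atTop]
  intro ε' hε'
  -- The step errors add up to at most `ε t / (T - t) = ε' t / (t + 1)`; the `+ 1` makes this
  -- strictly smaller than `ε'` and covers `t = 0`.
  set ε := ε' * (T - t) / (t + 1) with hεdef
  have hε : 0 < ε := by positivity
  obtain ⟨δ, hδ, hδE⟩ := Metric.uniformContinuousOn_iff.1 huc ε hε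
  obtain ⟨n₀, hn₀⟩ := exists_nat_gt (T / δ)
  refine ⟨n₀ + 1, fun n hn => ?_⟩
  have hn0 : n ≠ 0 := by omega
  have hnpos : (0 : ℝ) < n := by exact_mod_cast Nat.pos_of_ne_zero hn0
  have hmesh : T / n < δ := by
    rw [div_lt_iff₀ hnpos]
    rw [div_lt_iff₀ hδ] at hn₀
    have : (n₀ : ℝ) ≤ n := by exact_mod_cast (by omega : n₀ ≤ n)
    nlinarith
  set a := gridPoint T t n with ha
  have hmem : ∀ k, a k ∈ Set.Icc 0 t := fun k => ⟨gridPoint_nonneg hT.le ht0, gridPoint_le⟩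
  have hstep : ∀ k : ℕ, ‖(T - T * k / n)⁻¹ • (N (a (k + 1)) - N (a k)) - (E (a (k + 1)) - E (a k))‖
      ≤ (T - t)⁻¹ * (ε * (a (k + 1) - a k)) := by
    intro k
    rcases gridPoint_cases (t := t) (n := n) hT.le k with hk | ⟨hk, hk'⟩
    · rw [← hk, ← ha]
      have hak := hmem k
      have hak' := hmem (k + 1)
      have hle : a k ≤ a (k + 1) := gridPoint_mono hT.le (Nat.le_succ k)
      have hTa : 0 < T - a k := by linarith [hak.2]
      have hint : ∀ x ∈ Set.Icc 0 t, ∀ y ∈ Set.Icc 0 t, IntervalIntegrable E volume x y :=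
        fun x hx y hy => (hE.mono (Set.uIcc_subset_Icc hx hy)).intervalIntegrable
      have h0 : (0 : ℝ) ∈ Set.Icc 0 t := ⟨le_rfl, ht0⟩
      -- Subtracting the integral equation at consecutive grid points, and absorbing the change of
      -- the factor `T - r` into the integral, leaves an error governed by the oscillation of `E` on
      -- one cell.
      have hsub : N (a (k + 1)) - N (a k) =
          (T - a k) • (E (a (k + 1)) - E (a k)) - ∫ u in a k..a (k + 1), (E (a (k + 1)) - E u) := by
        have e1 := h _ hak
        have e2 := h _ hak'
        rw [intervalIntegral.integral_sub intervalIntegrable_const (hint _ hak _ hak'),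
          intervalIntegral.integral_const,
          ← intervalIntegral.integral_interval_sub_left (hint _ h0 _ hak') (hint _ h0 _ hak)]
        have e1' := eq_sub_of_add_eq' e1.symm
        have e2' := eq_sub_of_add_eq' e2.symm
        rw [e1', e2']
        module
      rw [hsub, smul_sub, inv_smul_smul₀ hTa.ne', sub_sub_cancel_left, norm_neg, norm_smul,
        norm_inv, Real.norm_of_nonneg hTa.le]
      have hbound : ‖∫ u in a k..a (k + 1), (E (a (k + 1)) - E u)‖ ≤ ε * (a (k + 1) - a k) := by
        rw [← abs_of_nonneg (sub_nonneg.2 hle)]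
        refine intervalIntegral.norm_integral_le_of_norm_le_const fun u hu => ?_
        rw [Set.uIoc_of_le hle] at hu
        rw [← dist_eq_norm]
        refine (hδE _ hak' _ ⟨hak.1.trans hu.1.le, hu.2.trans hak'.2⟩ ?_).le
        rw [Real.dist_eq, abs_of_nonneg (by linarith [hu.2])]
        have := gridPoint_succ_sub_le (T := T) (t := t) (n := n) (k := k) hT.le
        linarith [hu.1]
      refine mul_le_mul ?_ hbound (norm_nonneg _) (by positivity)
      exact inv_anti₀ hTt (by linarith [hak.2])
    · simp [ha, hk, hk']
  have htel : E t - E 0 = ∑ k ∈ Finset.range n, (E (a (k + 1)) - E (a k)) := by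
    rw [Finset.sum_range_sub (fun k => E (a k)), ha, gridPoint_self htT.le hn0, gridPoint_zero ht0]
  rw [htel, dist_eq_norm, riemannSum, ← Finset.sum_sub_distrib]
  calc _ ≤ ∑ k ∈ Finset.range n, (T - t)⁻¹ * (ε * (a (k + 1) - a k)) :=
        norm_sum_le_of_le _ fun k _ => hstep k
    _ = (T - t)⁻¹ * (ε * t) := by
        rw [← Finset.mul_sum, ← Finset.mul_sum, Finset.sum_range_sub (fun k => a k), ha,
          gridPoint_self htT.le hn0, gridPoint_zero ht0, sub_zero]
    _ < ε' := by
        rw [hεdef]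
        field_simp
        linarith

/-- The Riemann sums of `∫_0^t (T - r)⁻² dr`. -/
lemma tendsto_sum_inv_sq (hT : 0 < T) (ht0 : 0 ≤ t) (htT : t < T) :
    Tendsto (fun n : ℕ => ∑ k ∈ Finset.range n,
      (T - T * k / n)⁻¹ ^ 2 * (gridPoint T t n (k + 1) - gridPoint T t n k)) atTop
      (𝓝 (t / (T * (T - t)))) := by
  have hTt : 0 < T - t := sub_pos.2 htT
  -- The integrand has primitive `(T - r)⁻¹`, whose increments telescope. Each cell has relative
  -- error at most `(T - t)⁻¹ T / n`, and the increments sum to `(T - t)⁻¹ - T⁻¹`.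
  have hlim : Tendsto (fun n : ℕ => (T - t)⁻¹ * T * ((T - t)⁻¹ - T⁻¹) / n) atTop (𝓝 0) :=
    tendsto_const_div_atTop_nhds_zero_nat _
  rw [tendsto_iff_dist_tendsto_zero]
  refine squeeze_zero' (Eventually.of_forall fun _ => dist_nonneg) ?_ hlim
  filter_upwards [eventually_ne_atTop 0] with n hn0
  set a := gridPoint T t n with ha
  have hmem : ∀ k, a k ∈ Set.Icc 0 t := fun k => ⟨gridPoint_nonneg hT.le ht0, gridPoint_le⟩
  have hval : t / (T * (T - t)) =
      ∑ k ∈ Finset.range n, ((T - a (k + 1))⁻¹ - (T - a k)⁻¹) := by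
    rw [Finset.sum_range_sub (fun k => (T - a k)⁻¹), ha, gridPoint_self htT.le hn0,
      gridPoint_zero ht0, sub_zero]
    field_simp
    ring
  have hstep : ∀ k : ℕ, ‖(T - T * k / n)⁻¹ ^ 2 * (a (k + 1) - a k) -
      ((T - a (k + 1))⁻¹ - (T - a k)⁻¹)‖ ≤
      (T - t)⁻¹ * (T / n) * ((T - a (k + 1))⁻¹ - (T - a k)⁻¹) := by
    intro k
    rcases gridPoint_cases (t := t) (n := n) hT.le k with hk | ⟨hk, hk'⟩
    · rw [← hk, ← ha]
      have hak := hmem k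
      have hak' := hmem (k + 1)
      have hle : a k ≤ a (k + 1) := gridPoint_mono hT.le (Nat.le_succ k)
      have hTa : 0 < T - a k := by linarith [hak.2]
      have hTb : 0 < T - a (k + 1) := by linarith [hak'.2]
      have hmono : 0 ≤ (T - a (k + 1))⁻¹ - (T - a k)⁻¹ :=
        sub_nonneg.2 (inv_anti₀ hTb (by linarith))
      have heq : (T - a k)⁻¹ ^ 2 * (a (k + 1) - a k) - ((T - a (k + 1))⁻¹ - (T - a k)⁻¹) =
          -((T - a k)⁻¹ * (a (k + 1) - a k) * ((T - a (k + 1))⁻¹ - (T - a k)⁻¹)) := by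
        field_simp
        ring
      rw [heq, norm_neg, Real.norm_of_nonneg (by
        have := sub_nonneg.2 hle
        positivity)]
      refine mul_le_mul_of_nonneg_right ?_ hmono
      refine mul_le_mul (inv_anti₀ hTt (by linarith [hak.2])) ?_ (sub_nonneg.2 hle) (by positivity)
      exact gridPoint_succ_sub_le hT.le
    · simp [ha, hk, hk']
  rw [hval, dist_eq_norm, ← Finset.sum_sub_distrib]
  calc _ ≤ ∑ k ∈ Finset.range n, (T - t)⁻¹ * (T / n) * ((T - a (k + 1))⁻¹ - (T - a k)⁻¹) :=
        norm_sum_le_of_le _ fun k _ => hstep k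
    _ = (T - t)⁻¹ * T * ((T - t)⁻¹ - T⁻¹) / n := by
        rw [← Finset.mul_sum, Finset.sum_range_sub (fun k => (T - a k)⁻¹), ha,
          gridPoint_self htT.le hn0, gridPoint_zero ht0]
        ring

/-- The covariance of the Riemann sums for a process with independent increments. -/
lemma sum_sum_min_gridPoint {s : ℝ} (hT : 0 ≤ T) (hst : s ≤ t) (n : ℕ) (g : ℕ → ℝ) :
    ∑ k ∈ Finset.range n, ∑ l ∈ Finset.range n, g k * g l *
      (min (gridPoint T s n (k + 1)) (gridPoint T t n (l + 1))
        - min (gridPoint T s n (k + 1)) (gridPoint T t n l)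
        - min (gridPoint T s n k) (gridPoint T t n (l + 1))
        + min (gridPoint T s n k) (gridPoint T t n l)) =
    ∑ k ∈ Finset.range n, g k ^ 2 * (gridPoint T s n (k + 1) - gridPoint T s n k) := by
  -- Both grids use the same points `T k / n` and `s ≤ t`, so the minimum is again a point of the
  -- grid stopped at `s`. The mixed difference of `min` over two distinct cells therefore vanishes.
  have hmin : ∀ k l, min (gridPoint T s n k) (gridPoint T t n l) =
      gridPoint T s n (min k l) := fun k l => by
    rw [(gridPoint_mono (t := s) (n := n) hT).map_min]
    unfold gridPoint
    rw [min_min_min_comm, min_min_min_comm (c := T * l / n), min_eq_left hst, min_self]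
  refine Finset.sum_congr rfl fun k hk => ?_
  rw [Finset.sum_eq_single_of_mem k hk]
  · simp_rw [hmin]
    rw [min_self, min_self, min_eq_right (Nat.le_succ k), min_eq_left (Nat.le_succ k)]
    ring
  · intro l _ hl
    simp_rw [hmin]
    rcases lt_or_gt_of_ne hl with h | h
    · rw [min_eq_right (by omega : l + 1 ≤ k + 1), min_eq_right (by omega : l ≤ k + 1),
        min_eq_right (by omega : l + 1 ≤ k), min_eq_right (by omega : l ≤ k)]
      ring
    · rw [min_eq_left (by omega : k + 1 ≤ l + 1), min_eq_left (by omega : k + 1 ≤ l),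
        min_eq_left (by omega : k ≤ l + 1), min_eq_left (by omega : k ≤ l)]
      ring

end Grid

/-! ### Matrix action and the pooled covariance -/

section MatAct

variable {d : ℕ} {ι : Type*} [Fintype ι]

lemma inner_matAct (A : Matrix (Fin d) (Fin d) ℝ) (u x : Vec d) :
    ⟪u, matAct A x⟫ = ⟪matAct A.transpose u, x⟫ := by
  simp only [matAct, PiLp.inner_apply, Matrix.ofLp_toEuclideanCLM, RCLike.inner_apply, conj_trivial]
  change A.mulVec x ⬝ᵥ u.ofLp = x.ofLp ⬝ᵥ A.transpose.mulVec u
  rw [Matrix.mulVec_transpose, dotProduct_comm, Matrix.dotProduct_mulVec, dotProduct_comm]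

lemma ofLp_matAct (A : Matrix (Fin d) (Fin d) ℝ) (x : Vec d) :
    (matAct A x).ofLp = A.mulVec x.ofLp := rfl

lemma matAct_mul (A B : Matrix (Fin d) (Fin d) ℝ) (x : Vec d) :
    matAct (A * B) x = matAct A (matAct B x) := by
  simp [matAct]

lemma isUnit_det_sum_inv [Nonempty ι] {Λ : ι → Matrix (Fin d) (Fin d) ℝ}
    (hΛ : ∀ c, (Λ c).PosDef) : IsUnit (∑ c, (Λ c)⁻¹).det := by
  have : (∑ c, (Λ c)⁻¹).PosDef :=
    Matrix.posDef_sum Finset.univ_nonempty fun c _ => (hΛ c).inv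
  exact (Matrix.isUnit_iff_isUnit_det _).1 this.isUnit

lemma poolCov_mul_sum_inv [Nonempty ι] {Λ : ι → Matrix (Fin d) (Fin d) ℝ}
    (hΛ : ∀ c, (Λ c).PosDef) : poolCov Λ * ∑ c, (Λ c)⁻¹ = 1 :=
  Matrix.nonsing_inv_mul _ (isUnit_det_sum_inv hΛ)

lemma transpose_eq_self {A : Matrix (Fin d) (Fin d) ℝ} (hA : A.IsHermitian) : A.transpose = A := by
  simpa [Matrix.conjTranspose_eq_transpose_of_trivial] using hA.eq

lemma poolCov_transpose {Λ : ι → Matrix (Fin d) (Fin d) ℝ}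
    (hΛ : ∀ c, (Λ c).PosDef) : (poolCov Λ).transpose = poolCov Λ := by
  rw [poolCov, Matrix.transpose_nonsing_inv, Matrix.transpose_sum]
  congr 1
  exact Finset.sum_congr rfl fun c _ => transpose_eq_self (hΛ c).inv.isHermitian

end MatAct

/-! ### Calculus of cross-covariance matrices -/

section CrossCov

variable {Ω : Type*} {m : MeasurableSpace Ω} [mΩ : MeasurableSpace Ω] {P : Measure Ω}
  {S : Submodule ℝ (Ω → ℝ)} {d : ℕ}

/-- `Y` and `Z` are random vectors with coordinates in `S` and cross-covariance matrix `K`. -/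
structure HasCrossCov (S : Submodule ℝ (Ω → ℝ)) (P : Measure Ω) (Y Z : Ω → Vec d)
    (K : Matrix (Fin d) (Fin d) ℝ) : Prop where
  left_mem : ∀ u, (fun ω => ⟪u, Y ω⟫) ∈ S
  right_mem : ∀ u, (fun ω => ⟪u, Z ω⟫) ∈ S
  covariance_eq : ∀ u v : Vec d,
    cov[fun ω => ⟪u, Y ω⟫, fun ω => ⟪v, Z ω⟫; P] = u.ofLp ⬝ᵥ K.mulVec v.ofLp

namespace HasCrossCov

variable {Y Y' Z Z' : Ω → Vec d} {K K' : Matrix (Fin d) (Fin d) ℝ}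

lemma symm (h : HasCrossCov S P Y Z K) : HasCrossCov S P Z Y K.transpose where
  left_mem := h.right_mem
  right_mem := h.left_mem
  covariance_eq u v := by
    rw [covariance_comm, h.covariance_eq, Matrix.dotProduct_mulVec, dotProduct_comm,
      Matrix.mulVec_transpose]

lemma coord (h : HasCrossCov S P Y Z K) (i j : Fin d) :
    cov[fun ω => Y ω i, fun ω => Z ω j; P] = K i j := by
  simpa [PiLp.inner_apply, PiLp.single_apply, EuclideanSpace.single] using
    h.covariance_eq (EuclideanSpace.single i 1) (EuclideanSpace.single j 1)

lemma matAct_left (A : Matrix (Fin d) (Fin d) ℝ) (h : HasCrossCov S P Y Z K) :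
    HasCrossCov S P (fun ω => matAct A (Y ω)) Z (A * K) where
  left_mem u := by
    simp_rw [inner_matAct]
    exact h.left_mem _
  right_mem := h.right_mem
  covariance_eq u v := by
    simp_rw [inner_matAct]
    rw [h.covariance_eq, ofLp_matAct, Matrix.mulVec_transpose, ← Matrix.dotProduct_mulVec,
      Matrix.mulVec_mulVec]

lemma smul_left (a : ℝ) (h : HasCrossCov S P Y Z K) :
    HasCrossCov S P (fun ω => a • Y ω) Z (a • K) := by
  have : (fun ω => a • Y ω) = fun ω => matAct (a • (1 : Matrix (Fin d) (Fin d) ℝ)) (Y ω) := by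
    ext ω i
    simp [ofLp_matAct, Matrix.smul_mulVec]
  rw [this]
  simpa using h.matAct_left (a • 1)

lemma smul_right (a : ℝ) (h : HasCrossCov S P Y Z K) :
    HasCrossCov S P Y (fun ω => a • Z ω) (a • K) := by
  simpa using (h.symm.smul_left a).symm

variable [IsProbabilityMeasure P]

lemma zero_left (hZ : ∀ u, (fun ω => ⟪u, Z ω⟫) ∈ S) :
    HasCrossCov S P (fun _ => (0 : Vec d)) Z 0 where
  left_mem u := by simp only [inner_zero_right]; exact S.zero_mem
  right_mem := hZ
  covariance_eq u v := by simp

lemma add_left (hS : IsGaussianSpace m S P) (h : HasCrossCov S P Y Z K)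
    (h' : HasCrossCov S P Y' Z K') : HasCrossCov S P (fun ω => Y ω + Y' ω) Z (K + K') where
  left_mem u := by
    simp_rw [inner_add_right]
    exact S.add_mem (h.left_mem u) (h'.left_mem u)
  right_mem := h.right_mem
  covariance_eq u v := by
    simp_rw [inner_add_right]
    rw [Matrix.add_mulVec, dotProduct_add, ← h.covariance_eq, ← h'.covariance_eq]
    exact covariance_add_left (hS.memLp_two (h.left_mem u)) (hS.memLp_two (h'.left_mem u))
      (hS.memLp_two (h.right_mem v))

lemma sub_left (hS : IsGaussianSpace m S P) (h : HasCrossCov S P Y Z K)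
    (h' : HasCrossCov S P Y' Z K') : HasCrossCov S P (fun ω => Y ω - Y' ω) Z (K - K') := by
  simpa [sub_eq_add_neg] using h.add_left hS (h'.smul_left (-1))

lemma sum_left (hS : IsGaussianSpace m S P) {J : Type*} (s : Finset J) {Y : J → Ω → Vec d}
    {K : J → Matrix (Fin d) (Fin d) ℝ} (hZ : ∀ u, (fun ω => ⟪u, Z ω⟫) ∈ S)
    (h : ∀ j ∈ s, HasCrossCov S P (Y j) Z (K j)) :
    HasCrossCov S P (fun ω => ∑ j ∈ s, Y j ω) Z (∑ j ∈ s, K j) := by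
  classical
  induction s using Finset.induction_on with
  | empty => simpa using zero_left hZ
  | insert j s hj ih =>
    simp_rw [Finset.sum_insert hj]
    exact (h j (Finset.mem_insert_self j s)).add_left hS
      (ih fun i hi => h i (Finset.mem_insert_of_mem hi))

lemma add_right (hS : IsGaussianSpace m S P) (h : HasCrossCov S P Y Z K)
    (h' : HasCrossCov S P Y Z' K') : HasCrossCov S P Y (fun ω => Z ω + Z' ω) (K + K') := by
  simpa using (h.symm.add_left hS h'.symm).symm

lemma sub_right (hS : IsGaussianSpace m S P) (h : HasCrossCov S P Y Z K)
    (h' : HasCrossCov S P Y Z' K') : HasCrossCov S P Y (fun ω => Z ω - Z' ω) (K - K') := by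
  simpa using (h.symm.sub_left hS h'.symm).symm

lemma sum_right (hS : IsGaussianSpace m S P) {J : Type*} (s : Finset J) {Z : J → Ω → Vec d}
    {K : J → Matrix (Fin d) (Fin d) ℝ} (hY : ∀ u, (fun ω => ⟪u, Y ω⟫) ∈ S)
    (h : ∀ j ∈ s, HasCrossCov S P Y (Z j) (K j)) :
    HasCrossCov S P Y (fun ω => ∑ j ∈ s, Z j ω) (∑ j ∈ s, K j) := by
  simpa [Matrix.transpose_sum] using (sum_left hS s hY fun j hj => (h j hj).symm).symm

variable {ι : Type*} [Fintype ι]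

lemma weightedAvg_left (hS : IsGaussianSpace m S P) (Λ : ι → Matrix (Fin d) (Fin d) ℝ)
    {Y : ι → Ω → Vec d} {K : ι → Matrix (Fin d) (Fin d) ℝ}
    (hZ : ∀ u, (fun ω => ⟪u, Z ω⟫) ∈ S) (h : ∀ c, HasCrossCov S P (Y c) Z (K c)) :
    HasCrossCov S P (fun ω => weightedAvg Λ fun c => Y c ω) Z
      (poolCov Λ * ∑ c, (Λ c)⁻¹ * K c) :=
  (sum_left hS Finset.univ hZ fun c _ => (h c).matAct_left (Λ c)⁻¹).matAct_left (poolCov Λ)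

/-- Cross-covariances pass to almost sure limits. -/
lemma of_tendsto (hS : IsGaussianSpace m S P) {y z : ℕ → Ω → Vec d}
    {k : ℕ → Matrix (Fin d) (Fin d) ℝ} (h : ∀ n, HasCrossCov S P (y n) (z n) (k n))
    (hy : ∀ᵐ ω ∂P, Tendsto (fun n => y n ω) atTop (𝓝 (Y ω)))
    (hz : ∀ᵐ ω ∂P, Tendsto (fun n => z n ω) atTop (𝓝 (Z ω)))
    (hk : Tendsto k atTop (𝓝 K)) : HasCrossCov (aeSeqClosure S P) P Y Z K := by
  have key : ∀ {x : ℕ → Ω → Vec d} {X : Ω → Vec d},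
      (∀ᵐ ω ∂P, Tendsto (fun n => x n ω) atTop (𝓝 (X ω))) → ∀ u : Vec d,
      ∀ᵐ ω ∂P, Tendsto (fun n => ⟪u, x n ω⟫) atTop (𝓝 ⟪u, X ω⟫) := fun hx u => by
    filter_upwards [hx] with ω hω using tendsto_const_nhds.inner hω
  refine ⟨fun u => mem_aeSeqClosure (fun n => (h n).left_mem u) (key hy u),
    fun u => mem_aeSeqClosure (fun n => (h n).right_mem u) (key hz u), fun u v => ?_⟩
  refine tendsto_nhds_unique (hS.tendsto_covariance (fun n => (h n).left_mem u)
    (fun n => (h n).right_mem v) (key hy u) (key hz v)) ?_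
  simp_rw [fun n => (h n).covariance_eq u v]
  have hc : Continuous fun A : Matrix (Fin d) (Fin d) ℝ => u.ofLp ⬝ᵥ A.mulVec v.ofLp := by
    fun_prop
  exact (hc.tendsto K).comp hk

end HasCrossCov

end CrossCov

/-! ### The Gaussian space of the Brownian motions -/

section BrownianSpace

variable {Ω : Type*} {m : MeasurableSpace Ω} [mΩ : MeasurableSpace Ω] {P : Measure Ω}

/-- The linear span of a centered Gaussian process is a Gaussian space. -/
lemma IsGaussianProcess.isGaussianSpace_span {I : Type*} {Y : I → Ω → ℝ}
    (hY : IsGaussianProcess Y P) (hY0 : ∀ i, ∫ ω, Y i ω ∂P = 0) (hm : ∀ i, Measurable[m] (Y i)) :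
    IsGaussianSpace m (Submodule.span ℝ (Set.range Y)) P where
  hasGaussianLaw X hX := by
    obtain ⟨a, rfl⟩ := (Finsupp.mem_span_range_iff_exists_finsupp).1 hX
    exact (hY.smul a).hasGaussianLaw_sum (I := a.support)
  integral_eq_zero X hX := by
    obtain ⟨a, rfl⟩ := (Finsupp.mem_span_range_iff_exists_finsupp).1 hX
    simp only [Finsupp.sum, Finset.sum_apply, Pi.smul_apply, smul_eq_mul]
    rw [integral_finsetSum _ fun i _ => (hY.hasGaussianLaw_eval i).integrable.const_mul (a i)]
    simp [integral_const_mul, hY0]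
  exists_measurable X hX := by
    refine ⟨X, ?_, ae_eq_rfl⟩
    induction hX using Submodule.span_induction with
    | mem x hx => obtain ⟨i, rfl⟩ := hx; exact hm i
    | zero => exact measurable_const
    | add x y _ _ hx hy => exact hx.add hy
    | smul a x _ hx => exact hx.const_smul a

variable {d : ℕ} {ι : Type*} {W : ι → ℝ≥0 → Ω → Vec d}

/-- The coordinates of independent Brownian motions, as one real-valued process. -/
def brownianCoord (W : ι → ℝ≥0 → Ω → Vec d) (p : ι × Fin d × ℝ≥0) (ω : Ω) : ℝ :=
  W p.1 p.2.2 ω p.2.1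

/-- A finite index set is enlarged to a full box of components, coordinates and finitely many times.
On the box, independence across coordinates and then across components gives joint Gaussianity, and
the original family is a linear image. -/
lemma isGaussianProcess_brownianCoord [Finite ι] (hW : ∀ c, IsBrownianVec (W c) P)
    (hind : iIndepFun (fun (c : ι) (ω : Ω) (r : ℝ≥0) => W c r ω) P) :
    IsGaussianProcess (brownianCoord W) P where
  hasGaussianLaw J := by
    classical
    have := Fintype.ofFinite ι
    let R : Finset ℝ≥0 := J.image fun p => p.2.2
    have h1 : ∀ c, HasGaussianLaw (fun ω (i : Fin d) (r : R) => W c r ω i) P := fun c => by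
      refine iIndepFun.hasGaussianLaw (X := fun (i : Fin d) ω (r : R) => W c r ω i)
        (fun i => (IsPreBrownianReal.isGaussianProcess
          ((hW c).isBrownianReal i).toIsPreBrownianReal).hasGaussianLaw R) ?_
      exact (hW c).iIndepFun_coord.comp (fun _ x (r : R) => x r) fun _ => by fun_prop
    have h2 : HasGaussianLaw (fun ω c (i : Fin d) (r : R) => W c r ω i) P := by
      refine iIndepFun.hasGaussianLaw (X := fun c ω (i : Fin d) (r : R) => W c r ω i) h1 ?_
      exact hind.comp (fun _ x (i : Fin d) (r : R) => x r i) fun _ => by fun_prop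
    let L : (ι → Fin d → R → ℝ) →L[ℝ] (J → ℝ) := ContinuousLinearMap.pi fun j =>
      (ContinuousLinearMap.proj (R := ℝ) (φ := fun _ : R => ℝ)
          ⟨j.1.2.2, Finset.mem_image_of_mem _ j.2⟩).comp
        ((ContinuousLinearMap.proj (R := ℝ) (φ := fun _ : Fin d => R → ℝ) j.1.2.1).comp
          (ContinuousLinearMap.proj (R := ℝ) (φ := fun _ : ι => Fin d → R → ℝ) j.1.1))
    exact h2.map_fun L

/-- The Gaussian space generated by the Brownian motions. -/
def brownianSpace (W : ι → ℝ≥0 → Ω → Vec d) : Submodule ℝ (Ω → ℝ) :=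
  Submodule.span ℝ (Set.range (brownianCoord W))

lemma isGaussianSpace_brownianSpace [Finite ι] (hW : ∀ c, IsBrownianVec (W c) P)
    (hind : iIndepFun (fun (c : ι) (ω : Ω) (r : ℝ≥0) => W c r ω) P) :
    IsGaussianSpace (MeasurableSpace.comap (fun ω c r => W c r ω) inferInstance)
      (brownianSpace W) P := by
  refine IsGaussianProcess.isGaussianSpace_span (isGaussianProcess_brownianCoord hW hind)
    (fun p => ((hW p.1).isBrownianReal p.2.1).integral_eval p.2.2) fun p => ?_
  have h : Measurable fun x : ι → ℝ≥0 → Vec d => x p.1 p.2.2 p.2.1 := by fun_prop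
  exact h.comp (comap_measurable _)

lemma covariance_brownianCoord [DecidableEq ι] (hW : ∀ c, IsBrownianVec (W c) P)
    (hind : iIndepFun (fun (c : ι) (ω : Ω) (r : ℝ≥0) => W c r ω) P) (c c' : ι) (i j : Fin d)
    (r s : ℝ≥0) :
    cov[fun ω => W c r ω i, fun ω => W c' s ω j; P] =
      if c = c' ∧ i = j then (min r s : ℝ) else 0 := by
  have hL : ∀ c r i, MemLp (fun ω => W c r ω i) 2 P := fun c r i =>
    ((IsPreBrownianReal.isGaussianProcess
      ((hW c).isBrownianReal i).toIsPreBrownianReal).hasGaussianLaw_eval r).memLp_two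
  split_ifs with h
  · obtain ⟨rfl, rfl⟩ := h
    rw [((hW c).isBrownianReal i).covariance_fun_eval, NNReal.coe_min]
  · refine IndepFun.covariance_eq_zero ?_ (hL c r i) (hL c' s j)
    by_cases hc : c = c'
    · subst hc
      have hij : i ≠ j := fun hij => h ⟨rfl, hij⟩
      exact ((hW c).iIndepFun_coord.indepFun hij).comp
        (measurable_pi_apply r) (measurable_pi_apply s)
    · exact (hind.indepFun hc).comp (φ := fun x : ℝ≥0 → Vec d => x r i)
        (ψ := fun x : ℝ≥0 → Vec d => x s j) (by fun_prop) (by fun_prop)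

lemma hasCrossCov_brownian [Finite ι] [IsProbabilityMeasure P] [DecidableEq ι] (hW : ∀ c, IsBrownianVec (W c) P)
    (hind : iIndepFun (fun (c : ι) (ω : Ω) (r : ℝ≥0) => W c r ω) P) (c c' : ι) (r s : ℝ≥0) :
    HasCrossCov (brownianSpace W) P (W c r) (W c' s)
      ((if c = c' then (min r s : ℝ) else 0) • 1) := by
  have hmem : ∀ c r i, (fun ω => W c r ω i) ∈ brownianSpace W := fun c r i =>
    Submodule.subset_span ⟨(c, i, r), rfl⟩
  have hinner : ∀ c r (u : Vec d),
      (fun ω => ⟪u, W c r ω⟫) = fun ω => ∑ i, u i * W c r ω i := fun c r u => by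
    ext ω; simp [PiLp.inner_apply, mul_comm]
  have hmem' : ∀ c r (u : Vec d), (fun ω => ⟪u, W c r ω⟫) ∈ brownianSpace W := fun c r u => by
    rw [hinner]
    have : (fun ω => ∑ i, u i * W c r ω i) = ∑ i, u i • fun ω => W c r ω i := by
      ext ω; simp
    rw [this]
    exact Submodule.sum_mem _ fun i _ => Submodule.smul_mem _ _ (hmem c r i)
  have hS := isGaussianSpace_brownianSpace hW hind
  refine ⟨hmem' c r, hmem' c' s, fun u v => ?_⟩
  rw [hinner, hinner, covariance_fun_sum_fun_sum
    (fun i => (hS.memLp_two (hmem c r i)).const_mul _)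
    (fun i => (hS.memLp_two (hmem c' s i)).const_mul _)]
  simp_rw [covariance_const_mul_left, covariance_const_mul_right,
    covariance_brownianCoord hW hind]
  by_cases hc : c = c'
  · simp [hc, dotProduct, Matrix.smul_mulVec, mul_comm, mul_left_comm]
  · simp [hc]

end BrownianSpace

/-! ### Linearity of the weighted average and transition means -/

section WeightedAvg

variable {d : ℕ} {ι : Type*} [Fintype ι]

/-- The weighted average as a continuous linear map. -/
def weightedAvgCLM (Λ : ι → Matrix (Fin d) (Fin d) ℝ) : (ι → Vec d) →L[ℝ] Vec d :=
  (Matrix.toEuclideanCLM (𝕜 := ℝ) (poolCov Λ)).comp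
    (∑ c, (Matrix.toEuclideanCLM (𝕜 := ℝ) (Λ c)⁻¹).comp (ContinuousLinearMap.proj c))

lemma weightedAvg_eq_clm (Λ : ι → Matrix (Fin d) (Fin d) ℝ) (x : ι → Vec d) :
    weightedAvg Λ x = weightedAvgCLM Λ x := by
  simp [weightedAvg, weightedAvgCLM, matAct]

/-- The weights sum to the identity; this is the reason why the drift vanishes on average. -/
lemma weightedAvg_const [Nonempty ι] {Λ : ι → Matrix (Fin d) (Fin d) ℝ}
    (hΛ : ∀ c, (Λ c).PosDef) (v : Vec d) : weightedAvg Λ (fun _ => v) = v := by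
  have h : ∑ c, matAct (Λ c)⁻¹ v = matAct (∑ c, (Λ c)⁻¹) v := by
    simp [matAct]
  rw [weightedAvg, h, ← matAct_mul, poolCov_mul_sum_inv hΛ]
  simp [matAct]

lemma continuous_weightedAvg (Λ : ι → Matrix (Fin d) (Fin d) ℝ) : Continuous (weightedAvg Λ) := by
  simp_rw [funext (weightedAvg_eq_clm Λ)]
  exact (weightedAvgCLM Λ).continuous

lemma weightedAvg_add (Λ : ι → Matrix (Fin d) (Fin d) ℝ) (x y : ι → Vec d) :
    weightedAvg Λ (fun c => x c + y c) = weightedAvg Λ x + weightedAvg Λ y := by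
  simp_rw [weightedAvg_eq_clm]
  exact map_add _ x y

lemma weightedAvg_sub (Λ : ι → Matrix (Fin d) (Fin d) ℝ) (x y : ι → Vec d) :
    weightedAvg Λ (fun c => x c - y c) = weightedAvg Λ x - weightedAvg Λ y := by
  simp_rw [weightedAvg_eq_clm]
  exact map_sub _ x y

lemma weightedAvg_smul (Λ : ι → Matrix (Fin d) (Fin d) ℝ) (a : ℝ) (x : ι → Vec d) :
    weightedAvg Λ (fun c => a • x c) = a • weightedAvg Λ x := by
  simp_rw [weightedAvg_eq_clm]
  exact map_smul _ a x

/-- The two interpolation coefficients sum to 1, and the average is fixed by averaging. -/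
lemma weightedAvg_transMean [Nonempty ι] {Λ : ι → Matrix (Fin d) (Fin d) ℝ}
    (hΛ : ∀ c, (Λ c).PosDef) {T s t : ℝ} (hs : s ≠ T) (x : ι → Vec d) :
    weightedAvg Λ (transMean T s t Λ x) = weightedAvg Λ x := by
  have hTs : T - s ≠ 0 := sub_ne_zero.2 hs.symm
  have h : transMean T s t Λ x = fun c => ((T - t) / (T - s)) • x c +
    ((t - s) / (T - s)) • (fun _ : ι => weightedAvg Λ x) c := rfl
  rw [h, weightedAvg_add, weightedAvg_smul, weightedAvg_smul, weightedAvg_const hΛ, ← add_smul,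
    ← add_div, sub_add_sub_cancel, div_self hTs, one_smul]

/-- The transition means satisfy the Chapman-Kolmogorov relation. -/
lemma transMean_transMean [Nonempty ι] {Λ : ι → Matrix (Fin d) (Fin d) ℝ}
    (hΛ : ∀ c, (Λ c).PosDef) {T r s t : ℝ} (hr : r ≠ T) (hs : s ≠ T) (x : ι → Vec d) (c : ι) :
    transMean T s t Λ (transMean T r s Λ x) c = transMean T r t Λ x c := by
  have hTs : T - s ≠ 0 := sub_ne_zero.2 hs.symm
  have hTr : T - r ≠ 0 := sub_ne_zero.2 hr.symm
  rw [transMean, weightedAvg_transMean hΛ hr]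
  unfold transMean
  match_scalars <;> field_simp
  ring

end WeightedAvg

/-! ### Pathwise solution of the equation -/

section Path

variable {d : ℕ} {ι : Type*} [Fintype ι] {Λ : ι → Matrix (Fin d) (Fin d) ℝ} {T : ℝ}
  {x g : ι → ℝ → Vec d}

lemma continuousOn_drift (hx : ∀ c, ContinuousOn (x c) (Set.Icc 0 T)) {t : ℝ}
    (ht : t ∈ Set.Ico 0 T) (c : ι) :
    ContinuousOn (fun r => (T - r)⁻¹ • (x c r - weightedAvg Λ fun c' => x c' r))
      (Set.Icc 0 t) := by
  have hsub : Set.Icc 0 t ⊆ Set.Icc 0 T := Set.Icc_subset_Icc_right ht.2.le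
  have h1 : ContinuousOn (fun r => (T - r)⁻¹) (Set.Icc 0 t) :=
    (continuousOn_const.sub continuousOn_id).inv₀ fun r hr => by
      have := hr.2.trans_lt ht.2
      exact (sub_pos.2 this).ne'
  have h2 : ContinuousOn (fun r => weightedAvg Λ fun c' => x c' r) (Set.Icc 0 t) :=
    (continuous_weightedAvg Λ).comp_continuousOn (continuousOn_pi.2 fun c' => (hx c').mono hsub)
  exact h1.smul (((hx c).mono hsub).sub h2)

/-- The drift does not act on the weighted average. -/
lemma weightedAvg_path [Nonempty ι] (hΛ : ∀ c, (Λ c).PosDef)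
    (hx : ∀ c, ContinuousOn (x c) (Set.Icc 0 T))
    (hsde : ∀ c, ∀ t ∈ Set.Ico 0 T, x c t = x c 0
      + (∫ r in (0 : ℝ)..t, (T - r)⁻¹ • (weightedAvg Λ (fun c' => x c' r) - x c r)) + g c t)
    {t : ℝ} (ht : t ∈ Set.Ico 0 T) :
    weightedAvg Λ (fun c => x c t) =
      weightedAvg Λ (fun c => x c 0) + weightedAvg Λ (fun c => g c t) := by
  -- The drifts of all components are collected in one vector-valued function, so that the linear
  -- averaging map can be exchanged with the integral.
  let φ : ℝ → ι → Vec d := fun r c => (T - r)⁻¹ • (weightedAvg Λ (fun c' => x c' r) - x c r)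
  have hφ : IntervalIntegrable φ volume 0 t := by
    refine ContinuousOn.intervalIntegrable ?_
    rw [Set.uIcc_of_le ht.1]
    refine continuousOn_pi.2 fun c => ((continuousOn_drift (Λ := Λ) hx ht c).neg).congr ?_
    intro r _
    simp [φ, ← smul_neg]
  have hφ0 : ∀ r, weightedAvgCLM Λ (φ r) = 0 := fun r => by
    rw [← weightedAvg_eq_clm, weightedAvg_smul, weightedAvg_sub, weightedAvg_const hΛ, sub_self,
      smul_zero]
  have hcoord : ∀ c, (∫ r in (0 : ℝ)..t, φ r) c = ∫ r in (0 : ℝ)..t, φ r c := fun c =>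
    ((ContinuousLinearMap.proj (R := ℝ) (φ := fun _ : ι => Vec d)
      c).intervalIntegral_comp_comm hφ).symm
  have h : (fun c => x c t) = fun c => (x c 0 + (∫ r in (0 : ℝ)..t, φ r) c) + g c t := by
    ext1 c
    rw [hcoord]
    exact hsde c t ht
  rw [h, weightedAvg_add, weightedAvg_add, weightedAvg_eq_clm Λ (fun c => _),
    weightedAvg_eq_clm Λ (fun c => (∫ r in (0 : ℝ)..t, φ r) c),
    ← ContinuousLinearMap.intervalIntegral_comp_comm _ hφ]
  simp [hφ0, weightedAvg_eq_clm]

/-- The approximation of the noise of the path at time `t` by Riemann sums. -/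
def noiseApprox (T : ℝ) (Λ : ι → Matrix (Fin d) (Fin d) ℝ) (g : ι → ℝ → Vec d) (n : ℕ) (c : ι)
    (t : ℝ) : Vec d :=
  weightedAvg Λ (fun c' => g c' t) +
    (T - t) • riemannSum T t (fun r => g c r - weightedAvg Λ fun c' => g c' r) n

/-- The scaled deviation `E` satisfies the integral equation of `tendsto_riemannSum` with `N = g_c -
g̃`. The noise is then recovered from `X⁽ᶜ⁾_t = X̃_t + (T - t) E_t` after removing the part that is
linear in the initial value. -/
lemma tendsto_noiseApprox [Nonempty ι] (hΛ : ∀ c, (Λ c).PosDef)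
    (hx : ∀ c, ContinuousOn (x c) (Set.Icc 0 T))
    (hsde : ∀ c, ∀ t ∈ Set.Ico 0 T, x c t = x c 0
      + (∫ r in (0 : ℝ)..t, (T - r)⁻¹ • (weightedAvg Λ (fun c' => x c' r) - x c r)) + g c t)
    {t : ℝ} (ht : t ∈ Set.Ico 0 T) (c : ι) :
    Tendsto (fun n => noiseApprox T Λ g n c t) atTop
      (𝓝 (x c t - transMean T 0 t Λ (fun c' => x c' 0) c)) := by
  have hT : 0 < T := ht.1.trans_lt ht.2
  let E : ℝ → Vec d := fun r => (T - r)⁻¹ • (x c r - weightedAvg Λ fun c' => x c' r)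
  have hlim := tendsto_riemannSum hT ht.1 ht.2 (E := E)
    (N := fun r => g c r - weightedAvg Λ fun c' => g c' r)
    (continuousOn_drift hx ht c) fun r hr => by
      have hr' : r ∈ Set.Ico 0 T := ⟨hr.1, hr.2.trans_lt ht.2⟩
      have hTr : T - r ≠ 0 := by linarith [hr'.2]
      have hint : ∫ u in (0 : ℝ)..r, E u =
          -∫ u in (0 : ℝ)..r, (T - u)⁻¹ • (weightedAvg Λ (fun c' => x c' u) - x c u) := by
        rw [← intervalIntegral.integral_neg]
        congr 1
        ext1 u
        rw [← smul_neg, neg_sub]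
      rw [hint]
      simp only [E, sub_zero]
      rw [smul_inv_smul₀ hTr, smul_inv_smul₀ hT.ne', weightedAvg_path hΛ hx hsde hr']
      nth_rewrite 1 [hsde c r hr']
      abel
  have hTt : T - t ≠ 0 := by linarith [ht.2]
  have heq : x c t - transMean T 0 t Λ (fun c' => x c' 0) c =
      weightedAvg Λ (fun c' => g c' t) + (T - t) • (E t - E 0) := by
    simp only [E, sub_zero, transMean]
    rw [smul_sub, smul_inv_smul₀ hTt, weightedAvg_path hΛ hx hsde ht]
    have hT0 := hT.ne'
    match_scalars <;> field_simp <;> ring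
  rw [heq]
  exact tendsto_const_nhds.add (hlim.const_smul (T - t))

end Path

/-! ### Orthogonal splitting of the driving noise -/

section NoiseCov

variable {Ω : Type*} [MeasurableSpace Ω] {P : Measure Ω} [IsProbabilityMeasure P] {d : ℕ}
  {ι : Type*} [Fintype ι] {Λ : ι → Matrix (Fin d) (Fin d) ℝ}
  {W : ι → ℝ≥0 → Ω → Vec d}

/-- The driving noise `Λ_c^{1/2} W⁽ᶜ⁾`. -/
def drivingNoise (Λ : ι → Matrix (Fin d) (Fin d) ℝ) (W : ι → ℝ≥0 → Ω → Vec d) (ω : Ω) (c : ι)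
    (r : ℝ) : Vec d :=
  matAct (CFC.sqrt (Λ c)) (W c r.toNNReal ω)

variable [DecidableEq ι]

lemma hasCrossCov_drivingNoise (hΛ : ∀ c, (Λ c).PosDef) (hW : ∀ c, IsBrownianVec (W c) P)
    (hind : iIndepFun (fun (c : ι) (ω : Ω) (r : ℝ≥0) => W c r ω) P) (c c' : ι) {r s : ℝ}
    (hr : 0 ≤ r) (hs : 0 ≤ s) :
    HasCrossCov (brownianSpace W) P (fun ω => drivingNoise Λ W ω c r)
      (fun ω => drivingNoise Λ W ω c' s) (if c = c' then min r s • Λ c else 0) := by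
  have h := (((hasCrossCov_brownian hW hind c c' r.toNNReal s.toNNReal).matAct_left
    (CFC.sqrt (Λ c))).symm.matAct_left (CFC.sqrt (Λ c'))).symm
  convert! h using 1
  have hsymm : (CFC.sqrt (Λ c)).transpose = CFC.sqrt (Λ c) :=
    transpose_eq_self (Matrix.nonneg_iff_posSemidef.1 (CFC.sqrt_nonneg (Λ c))).isHermitian
  split_ifs with hc
  · subst hc
    have h2 : CFC.sqrt (Λ c) * CFC.sqrt (Λ c) = Λ c :=
      CFC.sqrt_mul_sqrt_self _ (Matrix.nonneg_iff_posSemidef.2 (hΛ c).posSemidef)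
    simp [hsymm, h2, hr, hs, transpose_eq_self (hΛ c).isHermitian]
  · simp

/-- The weighted average of the driving noise. -/
def avgNoise (Λ : ι → Matrix (Fin d) (Fin d) ℝ) (W : ι → ℝ≥0 → Ω → Vec d) (ω : Ω)
    (r : ℝ) : Vec d :=
  weightedAvg Λ fun c => drivingNoise Λ W ω c r

/-- Only the term of index `c` in the average correlates with `g_c`, and its weight cancels the
covariance: `Λ_𝒞 Λ_c⁻¹ Λ_c = Λ_𝒞`, whatever `c` is. -/
lemma hasCrossCov_avgNoise_drivingNoise (hΛ : ∀ c, (Λ c).PosDef)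
    (hW : ∀ c, IsBrownianVec (W c) P)
    (hind : iIndepFun (fun (c : ι) (ω : Ω) (r : ℝ≥0) => W c r ω) P) (c : ι) {r s : ℝ}
    (hr : 0 ≤ r) (hs : 0 ≤ s) :
    HasCrossCov (brownianSpace W) P (fun ω => avgNoise Λ W ω r)
      (fun ω => drivingNoise Λ W ω c s) (min r s • poolCov Λ) := by
  have hmem := (hasCrossCov_drivingNoise hΛ hW hind c c hs hs).left_mem
  have h := HasCrossCov.weightedAvg_left (isGaussianSpace_brownianSpace hW hind) Λ hmem
    fun c' => hasCrossCov_drivingNoise hΛ hW hind c' c hr hs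
  convert! h using 1
  have hdet : IsUnit (Λ c).det := (Matrix.isUnit_iff_isUnit_det _).1 (hΛ c).isUnit
  simp [Matrix.nonsing_inv_mul _ hdet]

lemma hasCrossCov_avgNoise [Nonempty ι] (hΛ : ∀ c, (Λ c).PosDef)
    (hW : ∀ c, IsBrownianVec (W c) P)
    (hind : iIndepFun (fun (c : ι) (ω : Ω) (r : ℝ≥0) => W c r ω) P) {r s : ℝ}
    (hr : 0 ≤ r) (hs : 0 ≤ s) :
    HasCrossCov (brownianSpace W) P (fun ω => avgNoise Λ W ω r)
      (fun ω => avgNoise Λ W ω s) (min r s • poolCov Λ) := by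
  have hmem := (hasCrossCov_avgNoise_drivingNoise hΛ hW hind (Classical.arbitrary ι) hs hs).left_mem
  have h := HasCrossCov.weightedAvg_left (isGaussianSpace_brownianSpace hW hind) Λ hmem
    fun c' => (hasCrossCov_avgNoise_drivingNoise hΛ hW hind c' hs hr).symm
  convert! h using 1
  simp only [Matrix.transpose_smul, poolCov_transpose hΛ, Matrix.mul_smul]
  rw [← Finset.smul_sum, ← Finset.sum_mul, Matrix.mul_smul, ← Matrix.mul_assoc,
    poolCov_mul_sum_inv hΛ, Matrix.one_mul, min_comm]

/-- The part of the driving noise that is orthogonal to its average. -/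
def residualNoise (Λ : ι → Matrix (Fin d) (Fin d) ℝ) (W : ι → ℝ≥0 → Ω → Vec d) (ω : Ω) (c : ι)
    (r : ℝ) : Vec d :=
  drivingNoise Λ W ω c r - avgNoise Λ W ω r

/-- The average has the same covariance with each `g_c` as with itself, so subtracting it leaves a
residual orthogonal to it. -/
lemma hasCrossCov_avgNoise_residualNoise [Nonempty ι] (hΛ : ∀ c, (Λ c).PosDef)
    (hW : ∀ c, IsBrownianVec (W c) P)
    (hind : iIndepFun (fun (c : ι) (ω : Ω) (r : ℝ≥0) => W c r ω) P) (c : ι) {r s : ℝ}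
    (hr : 0 ≤ r) (hs : 0 ≤ s) :
    HasCrossCov (brownianSpace W) P (fun ω => avgNoise Λ W ω r)
      (fun ω => residualNoise Λ W ω c s) 0 := by
  simpa [residualNoise] using (hasCrossCov_avgNoise_drivingNoise hΛ hW hind c hr hs).sub_right
    (isGaussianSpace_brownianSpace hW hind) (hasCrossCov_avgNoise hΛ hW hind hr hs)

/-- The covariance rate `δ_{cc'} Λ_c - Λ_𝒞` of the residual noise. -/
def residualCov (Λ : ι → Matrix (Fin d) (Fin d) ℝ) (c c' : ι) : Matrix (Fin d) (Fin d) ℝ :=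
  (if c = c' then Λ c else 0) - poolCov Λ

lemma hasCrossCov_residualNoise [Nonempty ι] (hΛ : ∀ c, (Λ c).PosDef)
    (hW : ∀ c, IsBrownianVec (W c) P)
    (hind : iIndepFun (fun (c : ι) (ω : Ω) (r : ℝ≥0) => W c r ω) P) (c c' : ι) {r s : ℝ}
    (hr : 0 ≤ r) (hs : 0 ≤ s) :
    HasCrossCov (brownianSpace W) P (fun ω => residualNoise Λ W ω c r)
      (fun ω => residualNoise Λ W ω c' s) (min r s • residualCov Λ c c') := by
  have hS := isGaussianSpace_brownianSpace hW hind
  have h := ((hasCrossCov_drivingNoise hΛ hW hind c c' hr hs).sub_right hS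
    (hasCrossCov_avgNoise_drivingNoise hΛ hW hind c hs hr).symm).sub_left hS
    (hasCrossCov_avgNoise_residualNoise hΛ hW hind c' hr hs)
  convert! h using 1
  rw [residualCov, smul_sub, smul_ite, Matrix.transpose_smul, poolCov_transpose hΛ, min_comm s r]
  simp

lemma hasCrossCov_avgNoise_riemannSum [Nonempty ι] (hΛ : ∀ c, (Λ c).PosDef)
    (hW : ∀ c, IsBrownianVec (W c) P)
    (hind : iIndepFun (fun (c : ι) (ω : Ω) (r : ℝ≥0) => W c r ω) P) (c : ι) {T r s : ℝ}
    (hT : 0 ≤ T) (hr : 0 ≤ r) (hs : 0 ≤ s) (n : ℕ) :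
    HasCrossCov (brownianSpace W) P (fun ω => avgNoise Λ W ω r)
      (fun ω => riemannSum T s (residualNoise Λ W ω c) n) 0 := by
  have hS := isGaussianSpace_brownianSpace hW hind
  have h := HasCrossCov.sum_right hS (Finset.range n)
    (hasCrossCov_avgNoise hΛ hW hind hr hr).left_mem fun k _ =>
    ((hasCrossCov_avgNoise_residualNoise hΛ hW hind c hr
      (gridPoint_nonneg (n := n) (k := k + 1) hT hs)).sub_right hS
    (hasCrossCov_avgNoise_residualNoise hΛ hW hind c hr
      (gridPoint_nonneg (n := n) (k := k) hT hs))).smul_right (T - T * k / n)⁻¹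
  simpa [riemannSum] using h

lemma hasCrossCov_riemannSum [Nonempty ι] (hΛ : ∀ c, (Λ c).PosDef)
    (hW : ∀ c, IsBrownianVec (W c) P)
    (hind : iIndepFun (fun (c : ι) (ω : Ω) (r : ℝ≥0) => W c r ω) P) (c c' : ι) {T s t : ℝ}
    (hT : 0 ≤ T) (hs : 0 ≤ s) (hst : s ≤ t) (n : ℕ) :
    HasCrossCov (brownianSpace W) P (fun ω => riemannSum T s (residualNoise Λ W ω c) n)
      (fun ω => riemannSum T t (residualNoise Λ W ω c') n)
      ((∑ k ∈ Finset.range n,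
        (T - T * k / n)⁻¹ ^ 2 * (gridPoint T s n (k + 1) - gridPoint T s n k)) •
          residualCov Λ c c') := by
  have hS := isGaussianSpace_brownianSpace hW hind
  have ht := hs.trans hst
  have hres := fun (k l : ℕ) => hasCrossCov_residualNoise hΛ hW hind c c'
    (gridPoint_nonneg (n := n) (k := k) hT hs) (gridPoint_nonneg (n := n) (k := l) hT ht)
  have h := HasCrossCov.sum_left hS (Finset.range n)
    (hasCrossCov_avgNoise_riemannSum hΛ hW hind c' hT hs ht n).right_mem fun k _ =>
    (HasCrossCov.sum_right hS (Finset.range n)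
      -- The index 0 is arbitrary: only membership in the Gaussian space is used.
      (((hres (k + 1) 0).sub_left hS (hres k 0)).smul_left (T - T * k / n)⁻¹).left_mem fun l _ =>
      ((((hres (k + 1) (l + 1)).sub_left hS (hres k (l + 1))).sub_right hS
        ((hres (k + 1) l).sub_left hS (hres k l))).smul_left
          (T - T * k / n)⁻¹).smul_right (T - T * l / n)⁻¹)
  convert! h using 1
  rw [← sum_sum_min_gridPoint hT hst n (fun k => (T - T * k / n)⁻¹), Finset.sum_smul]
  refine Finset.sum_congr rfl fun k _ => ?_
  rw [Finset.sum_smul]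
  refine Finset.sum_congr rfl fun l _ => ?_
  module

end NoiseCov

/-! ### Covariance of the noise of the process, up to the terminal time -/

section ProcessNoise

variable {Ω : Type*} {m : MeasurableSpace Ω} [mΩ : MeasurableSpace Ω] {P : Measure Ω}
  [IsProbabilityMeasure P] {d : ℕ} {ι : Type*} [Fintype ι]
  {T : ℝ} {Λ : ι → Matrix (Fin d) (Fin d) ℝ} {f : ι → Vec d → ℝ}
  {W : ι → ℝ≥0 → Ω → Vec d} {X : ι → ℝ → Ω → Vec d}

/-- The deviation of `X⁽ᶜ⁾ₜ` from its conditional mean given the initial values. -/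
def processNoise (T : ℝ) (Λ : ι → Matrix (Fin d) (Fin d) ℝ) (X : ι → ℝ → Ω → Vec d) (c : ι)
    (t : ℝ) (ω : Ω) : Vec d :=
  X c t ω - transMean T 0 t Λ (fun c' => X c' 0 ω) c

variable [DecidableEq ι]

/-- The cross-covariance of the noise of `X⁽ᶜ⁾` at time `s` and of `X⁽ᶜ'⁾` at time `t`. -/
def noiseCov (T : ℝ) (Λ : ι → Matrix (Fin d) (Fin d) ℝ) (c c' : ι) (s t : ℝ) :
    Matrix (Fin d) (Fin d) ℝ :=
  min s t • poolCov Λ + (min s t - s * t / T) • residualCov Λ c c'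

lemma noiseCov_transpose (hΛ : ∀ c, (Λ c).PosDef) (c c' : ι) (s t : ℝ) :
    (noiseCov T Λ c c' s t).transpose = noiseCov T Λ c' c t s := by
  have h : (residualCov Λ c c').transpose = residualCov Λ c' c := by
    rw [residualCov, residualCov, Matrix.transpose_sub, poolCov_transpose hΛ]
    congr 1
    by_cases hc : c = c'
    · subst hc
      simp [transpose_eq_self (hΛ c).isHermitian]
    · simp [hc, Ne.symm hc]
  rw [noiseCov, noiseCov, Matrix.transpose_add, Matrix.transpose_smul, Matrix.transpose_smul, h,
    poolCov_transpose hΛ, min_comm, mul_comm]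

/-- The terms mixing the average noise with a residual Riemann sum vanish, so the covariance splits
into a Brownian part and a residual part. -/
lemma hasCrossCov_noiseApprox [Nonempty ι] (hΛ : ∀ c, (Λ c).PosDef)
    (hW : ∀ c, IsBrownianVec (W c) P)
    (hind : iIndepFun (fun (c : ι) (ω : Ω) (r : ℝ≥0) => W c r ω) P) (c c' : ι) {s t : ℝ}
    (hT : 0 ≤ T) (hs : 0 ≤ s) (hst : s ≤ t) (n : ℕ) :
    HasCrossCov (brownianSpace W) P (fun ω => noiseApprox T Λ (drivingNoise Λ W ω) n c s)
      (fun ω => noiseApprox T Λ (drivingNoise Λ W ω) n c' t)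
      (s • poolCov Λ + ((T - s) * (T - t) * ∑ k ∈ Finset.range n,
        (T - T * k / n)⁻¹ ^ 2 * (gridPoint T s n (k + 1) - gridPoint T s n k)) •
          residualCov Λ c c') := by
  have hS := isGaussianSpace_brownianSpace hW hind
  have ht := hs.trans hst
  have h1 := (hasCrossCov_avgNoise hΛ hW hind hs ht).add_right hS
    ((hasCrossCov_avgNoise_riemannSum hΛ hW hind c' hT hs ht n).smul_right (T - t))
  have h2 := (hasCrossCov_avgNoise_riemannSum hΛ hW hind c hT ht hs n).symm.add_right hS
    ((hasCrossCov_riemannSum hΛ hW hind c c' hT hs hst n).smul_right (T - t))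
  have h := h1.add_left hS (h2.smul_left (T - s))
  convert! h using 1
  rw [min_eq_left hst, Matrix.transpose_zero]
  module

/-- In the limit the residual factor is `(T - s)(T - t) · s / (T (T - s)) = s - st/T`, the
covariance of a standard bridge on `[0, T]`. -/
lemma hasCrossCov_processNoise_of_le [Nonempty ι] (hΛ : ∀ c, (Λ c).PosDef)
    (hX : IsProposalProcess T Λ f W X P) (c c' : ι) {s t : ℝ} (hs : 0 ≤ s) (hst : s ≤ t)
    (ht : t < T) :
    HasCrossCov (aeSeqClosure (brownianSpace W) P) P (processNoise T Λ X c s)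
      (processNoise T Λ X c' t) (noiseCov T Λ c c' s t) := by
  have hT : 0 < T := (hs.trans hst).trans_lt ht
  have hlim : ∀ c, ∀ t ∈ Set.Ico 0 T, ∀ᵐ ω ∂P, Tendsto
      (fun n => noiseApprox T Λ (drivingNoise Λ W ω) n c t) atTop
      (𝓝 (processNoise T Λ X c t ω)) := fun c t ht => by
    filter_upwards [hX.sde] with ω hω
    exact tendsto_noiseApprox (x := fun c t => X c t ω) hΛ (fun c => hX.continuousOn c ω) hω ht c
  refine HasCrossCov.of_tendsto (isGaussianSpace_brownianSpace hX.brownian hX.iIndepFun_brownian)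
    (fun n => hasCrossCov_noiseApprox hΛ hX.brownian hX.iIndepFun_brownian c c' hT.le hs hst n)
    (hlim c s ⟨hs, hst.trans_lt ht⟩) (hlim c' t ⟨hs.trans hst, ht⟩) ?_
  have h := tendsto_sum_inv_sq hT hs (hst.trans_lt ht)
  have hcov : Tendsto (fun n : ℕ => s • poolCov Λ + ((T - s) * (T - t) * ∑ k ∈ Finset.range n,
      (T - T * k / n)⁻¹ ^ 2 * (gridPoint T s n (k + 1) - gridPoint T s n k)) • residualCov Λ c c')
      atTop (𝓝 (s • poolCov Λ + ((T - s) * (T - t) * (s / (T * (T - s)))) • residualCov Λ c c')) :=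
    tendsto_const_nhds.add ((h.const_mul ((T - s) * (T - t))).smul_const _)
  convert! hcov using 2
  rw [noiseCov, min_eq_left hst]
  have : T - s ≠ 0 := by linarith
  congr 2
  field_simp

lemma hasCrossCov_processNoise_of_lt [Nonempty ι] (hΛ : ∀ c, (Λ c).PosDef)
    (hX : IsProposalProcess T Λ f W X P) (c c' : ι) {s t : ℝ} (hs : s ∈ Set.Ico 0 T)
    (ht : t ∈ Set.Ico 0 T) :
    HasCrossCov (aeSeqClosure (brownianSpace W) P) P (processNoise T Λ X c s)
      (processNoise T Λ X c' t) (noiseCov T Λ c c' s t) := by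
  rcases le_total s t with hst | hts
  · exact hasCrossCov_processNoise_of_le hΛ hX c c' hs.1 hst ht.2
  · rw [← noiseCov_transpose hΛ]
    exact (hasCrossCov_processNoise_of_le hΛ hX c' c ht.1 hts hs.2).symm

lemma hasCrossCov_processNoise [Nonempty ι] (hT : 0 < T) (hΛ : ∀ c, (Λ c).PosDef)
    (hX : IsProposalProcess T Λ f W X P) (c c' : ι) {s t : ℝ} (hs : s ∈ Set.Icc 0 T)
    (ht : t ∈ Set.Icc 0 T) :
    HasCrossCov (aeSeqClosure (aeSeqClosure (brownianSpace W) P) P) P (processNoise T Λ X c s)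
      (processNoise T Λ X c' t) (noiseCov T Λ c c' s t) := by
  -- The equation says nothing at `T`, so times are approximated from inside `[0, T)` and path
  -- continuity gives the limit. This is the reason for the second closure of the Gaussian space.
  let τ : ℕ → ℝ → ℝ := fun n t => min t (T - T / (n + 1 : ℝ))
  have hτ0 : Tendsto (fun n : ℕ => T / (n + 1 : ℝ)) atTop (𝓝 0) := by
    simpa [div_eq_mul_inv] using (tendsto_one_div_add_atTop_nhds_zero_nat (𝕜 := ℝ)).const_mul T
  have hτmem : ∀ t ∈ Set.Icc 0 T, ∀ n, τ n t ∈ Set.Ico 0 T := fun t ht n => by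
    have h1 : 0 < T / (n + 1 : ℝ) := by positivity
    have h2 : T / (n + 1 : ℝ) ≤ T := div_le_self hT.le (by
      have : (0 : ℝ) ≤ n := n.cast_nonneg
      linarith)
    exact ⟨le_min ht.1 (by linarith), (min_le_right _ _).trans_lt (by linarith)⟩
  have hτlim : ∀ t ∈ Set.Icc 0 T, Tendsto (fun n => τ n t) atTop (𝓝 t) := fun t ht => by
    have h := (tendsto_const_nhds (x := t)).min (hτ0.const_sub T)
    rwa [sub_zero, min_eq_left ht.2] at h
  have hlim : ∀ c, ∀ t ∈ Set.Icc 0 T, ∀ᵐ ω ∂P, Tendsto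
      (fun n => processNoise T Λ X c (τ n t) ω) atTop (𝓝 (processNoise T Λ X c t ω)) :=
    fun c t ht => ae_of_all _ fun ω => by
      have hc : ContinuousOn (fun t => processNoise T Λ X c t ω) (Set.Icc 0 T) := by
        unfold processNoise transMean
        have := hX.continuousOn c ω
        fun_prop
      exact (hc t ht).tendsto.comp (tendsto_nhdsWithin_iff.2 ⟨hτlim t ht,
        Eventually.of_forall fun n => Set.Ico_subset_Icc_self (hτmem t ht n)⟩)
  refine HasCrossCov.of_tendsto
    (isGaussianSpace_brownianSpace hX.brownian hX.iIndepFun_brownian).aeSeqClosure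
    (fun n => hasCrossCov_processNoise_of_lt hΛ hX c c' (hτmem s hs n) (hτmem t ht n))
    (hlim c s hs) (hlim c' t ht) ?_
  have h1 := (hτlim s hs).min (hτlim t ht)
  exact (h1.smul_const _).add
    ((h1.sub (((hτlim s hs).mul (hτlim t ht)).div_const T)).smul_const _)

end ProcessNoise

/-! ### From zero covariance to independence and Gaussian conditional laws -/

section Independence

variable {Ω : Type*} {m : MeasurableSpace Ω} [mΩ : MeasurableSpace Ω] {P : Measure Ω}
  [IsProbabilityMeasure P] {d : ℕ} {S : Submodule ℝ (Ω → ℝ)}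

/-- Uncorrelated families of a Gaussian space are independent, also jointly with a random variable
that is independent of the Gaussian space. -/
lemma indepFun_prodMk_of_hasCrossCov_zero (hS : IsGaussianSpace m S P) {I J β : Type*}
    [Countable I] [MeasurableSpace β] {U : Ω → β} (hU : Measurable U)
    (hUm : Indep (MeasurableSpace.comap U inferInstance) m P)
    {Y : I → Ω → Vec d} {Z : J → Ω → Vec d} (hYm : ∀ i, Measurable (Y i))
    (hZm : ∀ j, Measurable (Z j)) (hY : ∀ i u, (fun ω => ⟪u, Y i ω⟫) ∈ S)
    (hZ : ∀ j u, (fun ω => ⟪u, Z j ω⟫) ∈ S) (hYZ : ∀ i j, HasCrossCov S P (Y i) (Z j) 0) :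
    IndepFun (fun ω => (U ω, fun i => Y i ω)) (fun ω j => Z j ω) P := by
  refine indepFun_prodMk_of_indepFun hU.aemeasurable (by fun_prop)
    (measurable_pi_lambda _ hZm).aemeasurable ?_ ?_
  · have h := hS.indepFun_process (Y := Sum.elim Y Z)
      (fun i u => by rcases i with i | j; exacts [hY i u, hZ j u]) hUm
    exact h.comp (ψ := fun x : I ⊕ J → Vec d => (fun i => x (Sum.inl i), fun j => x (Sum.inr j)))
      measurable_id (by fun_prop)
  · refine hS.indepFun_of_covariance_inner hY hZ fun i j u v => ?_
    simpa using (hYZ i j).covariance_eq u v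

/-- The conditional law of a translate of an independent Gaussian vector. -/
lemma hasCondLaw_of_indepFun {α κ : Type*} [MeasurableSpace α] [Fintype κ] [DecidableEq κ]
    {X : Ω → α} {Y R : Ω → EuclideanSpace ℝ κ} {μ : α → EuclideanSpace ℝ κ} {V : Matrix κ κ ℝ}
    (hX : AEMeasurable X P) (hμ : Measurable μ) (hR : HasLaw R (multivariateGaussian 0 V) P)
    (hXR : IndepFun X R P) (hY : ∀ ω, Y ω = μ (X ω) + R ω) :
    HasCondLaw Y X (fun x => multivariateGaussian (μ x) V) P := by
  obtain ⟨κ, hκ, h⟩ := exists_hasCondDistrib_of_indepFun (g := fun x r => μ x + r) hX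
    hR.aemeasurable hXR (by fun_prop) (ae_of_all _ hY)
  refine ⟨κ, fun x => ?_, h⟩
  rw [hκ, hR.map_eq, multivariateGaussian,
    Measure.map_map (by fun_prop) (by fun_prop)]
  congr 1
  ext1 y
  simp

end Independence

/-! ### Transition laws and the terminal value -/

section Transition

variable {Ω : Type*}
  {d : ℕ} {ι : Type*} [Fintype ι]
  {T : ℝ} {Λ : ι → Matrix (Fin d) (Fin d) ℝ} {f : ι → Vec d → ℝ}
  {W : ι → ℝ≥0 → Ω → Vec d} {X : ι → ℝ → Ω → Vec d}

lemma continuous_transMean (T s t : ℝ) (Λ : ι → Matrix (Fin d) (Fin d) ℝ) (c : ι) :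
    Continuous fun x : ι → Vec d => transMean T s t Λ x c := by
  have := continuous_weightedAvg Λ
  unfold transMean
  fun_prop

lemma transMean_sub (T s t : ℝ) (Λ : ι → Matrix (Fin d) (Fin d) ℝ) (x y : ι → Vec d) (c : ι) :
    transMean T s t Λ (fun c' => x c' - y c') c = transMean T s t Λ x c - transMean T s t Λ y c := by
  unfold transMean
  rw [weightedAvg_sub]
  module

/-- The deviation of `X⁽ᶜ⁾ₜ` from its conditional mean given `X_s`. -/
def transResidual (T : ℝ) (Λ : ι → Matrix (Fin d) (Fin d) ℝ) (X : ι → ℝ → Ω → Vec d) (s t : ℝ)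
    (c : ι) (ω : Ω) : Vec d :=
  X c t ω - transMean T s t Λ (fun c' => X c' s ω) c

/-- By the Chapman-Kolmogorov relation the contributions of the initial values cancel. The residual
thus lies in the Gaussian space although `X_0` need not be Gaussian. -/
lemma transResidual_eq [Nonempty ι] (hT : 0 < T) (hΛ : ∀ c, (Λ c).PosDef) {s : ℝ} (hs : s < T)
    (t : ℝ) (c : ι) (ω : Ω) :
    transResidual T Λ X s t c ω =
      processNoise T Λ X c t ω - transMean T s t Λ (fun c' => processNoise T Λ X c' s ω) c := by
  unfold transResidual processNoise
  rw [transMean_sub, transMean_transMean hΛ hT.ne hs.ne]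
  abel

variable [mΩ : MeasurableSpace Ω] {P : Measure Ω}

lemma measurable_processNoise (hT : 0 ≤ T) (hX : IsProposalProcess T Λ f W X P) (c : ι) {t : ℝ}
    (ht : t ∈ Set.Icc 0 T) : Measurable (processNoise T Λ X c t) :=
  (hX.measurable c t ht).sub ((continuous_transMean T 0 t Λ c).measurable.comp
    (measurable_pi_lambda _ fun c' => hX.measurable c' 0 ⟨le_rfl, hT⟩))

/-- The Gaussian space of the noise of the process. -/
def noiseSpace (W : ι → ℝ≥0 → Ω → Vec d) (P : Measure Ω) : Submodule ℝ (Ω → ℝ) :=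
  aeSeqClosure (aeSeqClosure (brownianSpace W) P) P

lemma measurable_transResidual (hX : IsProposalProcess T Λ f W X P) (c : ι) {s t : ℝ}
    (hs : s ∈ Set.Icc 0 T) (ht : t ∈ Set.Icc 0 T) : Measurable (transResidual T Λ X s t c) :=
  (hX.measurable c t ht).sub ((continuous_transMean T s t Λ c).measurable.comp
    (measurable_pi_lambda _ fun c' => hX.measurable c' s hs))

lemma indep_init_noise (hX : IsProposalProcess T Λ f W X P) :
    Indep (MeasurableSpace.comap (fun ω c => X c 0 ω) inferInstance)
      (MeasurableSpace.comap (fun ω c r => W c r ω) inferInstance) P :=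
  (IndepFun_iff_Indep _ _ _).1 hX.indepFun_init_brownian

variable [IsProbabilityMeasure P]

lemma isGaussianSpace_noiseSpace (hX : IsProposalProcess T Λ f W X P) :
    IsGaussianSpace (MeasurableSpace.comap (fun ω c r => W c r ω) inferInstance)
      (noiseSpace W P) P :=
  (isGaussianSpace_brownianSpace hX.brownian hX.iIndepFun_brownian).aeSeqClosure.aeSeqClosure

variable [DecidableEq ι] [Nonempty ι]

/-- The residual covariances average to zero, since `Λ_c⁻¹ Λ_c - (∑ Λ_{c'}⁻¹) Λ_𝒞 = 0`; only the
Brownian part with covariance `Λ_𝒞` survives. -/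
lemma hasCrossCov_weightedAvg_processNoise (hT : 0 < T) (hΛ : ∀ c, (Λ c).PosDef)
    (hX : IsProposalProcess T Λ f W X P) (c : ι) {s t : ℝ} (hs : s ∈ Set.Icc 0 T)
    (ht : t ∈ Set.Icc 0 T) :
    HasCrossCov (noiseSpace W P) P (fun ω => weightedAvg Λ fun c' => processNoise T Λ X c' s ω)
      (processNoise T Λ X c t) (min s t • poolCov Λ) := by
  have h := HasCrossCov.weightedAvg_left (isGaussianSpace_noiseSpace hX) Λ
    (hasCrossCov_processNoise hT hΛ hX c c ht ht).left_mem
    fun c' => hasCrossCov_processNoise hT hΛ hX c' c hs ht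
  convert! h using 1
  have hdet : IsUnit (Λ c).det := (Matrix.isUnit_iff_isUnit_det _).1 (hΛ c).isUnit
  have h0 : ∑ c', (Λ c')⁻¹ * residualCov Λ c' c = 0 := by
    simp only [residualCov, Matrix.mul_sub, Finset.sum_sub_distrib, mul_ite, Matrix.mul_zero,
      Finset.sum_ite_eq', Finset.mem_univ, if_true, ← Finset.sum_mul]
    rw [Matrix.nonsing_inv_mul _ hdet, poolCov, Matrix.mul_nonsing_inv _ (isUnit_det_sum_inv hΛ),
      sub_self]
  simp only [noiseCov, Matrix.mul_add, Matrix.mul_smul, Finset.sum_add_distrib, ← Finset.smul_sum,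
    h0, smul_zero, add_zero, ← Finset.sum_mul]
  rw [← Matrix.mul_assoc, poolCov_mul_sum_inv hΛ, Matrix.one_mul]

lemma hasCrossCov_transResidual_processNoise (hT : 0 < T) (hΛ : ∀ c, (Λ c).PosDef)
    (hX : IsProposalProcess T Λ f W X P) (c c' : ι) {r s t : ℝ} (hr : r ∈ Set.Icc 0 T)
    (hs : s ∈ Set.Ico 0 T) (ht : t ∈ Set.Icc 0 T) :
    HasCrossCov (noiseSpace W P) P (transResidual T Λ X s t c) (processNoise T Λ X c' r)
      (noiseCov T Λ c c' t r - (((T - t) / (T - s)) • noiseCov T Λ c c' s r +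
        ((t - s) / (T - s)) • min s r • poolCov Λ)) := by
  have hS := isGaussianSpace_noiseSpace hX
  have hs' := Set.Ico_subset_Icc_self hs
  rw [funext (transResidual_eq (X := X) hT hΛ hs.2 t c)]
  exact (hasCrossCov_processNoise hT hΛ hX c c' ht hr).sub_left hS
    (((hasCrossCov_processNoise hT hΛ hX c c' hs' hr).smul_left _).add_left hS
      ((hasCrossCov_weightedAvg_processNoise hT hΛ hX c' hs' hr).smul_left _))

/-- The transition mean is the Gaussian regression on the noise at time `s`: its coefficients carry
the covariance at `(s, s)` to the one at `(t, s)`. -/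
lemma hasCrossCov_transResidual_processNoise_zero (hT : 0 < T) (hΛ : ∀ c, (Λ c).PosDef)
    (hX : IsProposalProcess T Λ f W X P) (c c' : ι) {s t : ℝ}
    (hs : 0 ≤ s) (hst : s < t) (ht : t ≤ T) :
    HasCrossCov (noiseSpace W P) P (transResidual T Λ X s t c) (processNoise T Λ X c' s) 0 := by
  have hTs : T - s ≠ 0 := by linarith
  convert! hasCrossCov_transResidual_processNoise hT hΛ hX c c' ⟨hs, hst.le.trans ht⟩
    ⟨hs, hst.trans_le ht⟩ ⟨hs.trans hst.le, ht⟩ using 1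
  rw [noiseCov, noiseCov, min_eq_right hst.le, min_self]
  match_scalars <;> field_simp <;> ring

/-- The residual is orthogonal to the noise at time `s`, so its covariance with another residual
equals its covariance with the noise at time `t`. -/
lemma hasCrossCov_transResidual (hT : 0 < T) (hΛ : ∀ c, (Λ c).PosDef)
    (hX : IsProposalProcess T Λ f W X P) (c c' : ι) {s t : ℝ}
    (hs : 0 ≤ s) (hst : s < t) (ht : t ≤ T) :
    HasCrossCov (noiseSpace W P) P (transResidual T Λ X s t c) (transResidual T Λ X s t c')
      (transCovBlock T s t Λ c c') := by
  have hS := isGaussianSpace_noiseSpace hX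
  have hsT := hst.trans_le ht
  have hTs : T - s ≠ 0 := by linarith
  have h0 := fun c'' => (hasCrossCov_transResidual_processNoise_zero hT hΛ hX c c'' hs hst ht).symm
  have h := (hasCrossCov_transResidual_processNoise hT hΛ hX c c' (r := t) ⟨hs.trans hst.le, ht⟩
    ⟨hs, hsT⟩ ⟨hs.trans hst.le, ht⟩).sub_right hS
    (((h0 c').smul_left ((T - t) / (T - s))).add_left hS
      ((HasCrossCov.weightedAvg_left hS Λ (h0 c').right_mem h0).smul_left
        ((t - s) / (T - s)))).symm
  rw [funext (transResidual_eq (X := X) hT hΛ hsT t c')]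
  convert! h using 1
  rw [noiseCov, noiseCov, min_self, min_eq_left hst.le, transCovBlock, residualCov]
  split_ifs with hc
  · simp only [Matrix.transpose_zero, Matrix.mul_zero, Finset.sum_const_zero, smul_zero, add_zero,
      sub_zero]
    match_scalars <;> field_simp <;> ring
  · simp only [Matrix.transpose_zero, Matrix.mul_zero, Finset.sum_const_zero, smul_zero, add_zero,
      sub_zero, zero_sub]
    match_scalars
    field_simp
    ring

/-- The state `X_s` is a function of the initial values and of the noise at time `s`, and the
residual is independent of this pair. -/
lemma indepFun_transResidual (hT : 0 < T) (hΛ : ∀ c, (Λ c).PosDef)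
    (hX : IsProposalProcess T Λ f W X P) {s t : ℝ} (hs : 0 ≤ s) (hst : s < t) (ht : t ≤ T) :
    IndepFun (fun ω c => X c s ω) (fun ω c => transResidual T Λ X s t c ω) P := by
  have hs' : s ∈ Set.Icc 0 T := ⟨hs, hst.le.trans ht⟩
  have ht' : t ∈ Set.Icc 0 T := ⟨hs.trans hst.le, ht⟩
  have h0 := fun c c' => hasCrossCov_transResidual_processNoise_zero hT hΛ hX c c' hs hst ht
  have h := indepFun_prodMk_of_hasCrossCov_zero (isGaussianSpace_noiseSpace hX)
    (measurable_pi_lambda _ fun c => hX.measurable c 0 ⟨le_rfl, hT.le⟩) (indep_init_noise hX)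
    (Y := fun c => processNoise T Λ X c s) (Z := fun c => transResidual T Λ X s t c)
    (fun c => measurable_processNoise hT.le hX c hs')
    (fun c => measurable_transResidual hX c hs' ht') (fun c => (h0 c c).right_mem)
    (fun c => (h0 c c).left_mem) fun c c' => by simpa using (h0 c' c).symm
  have hφ : Measurable fun (p : (ι → Vec d) × (ι → Vec d)) (c : ι) =>
      transMean T 0 s Λ p.1 c + p.2 c :=
    measurable_pi_lambda _ fun c => ((continuous_transMean T 0 s Λ c).measurable.comp
      measurable_fst).add (by fun_prop)
  convert! h.comp hφ measurable_id using 1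
  ext1 ω
  ext1 c
  simp [processNoise]

/-- The law of the transition from time `s` to time `t`, for `t ≤ T`. -/
lemma hasLaw_stack_transResidual (hT : 0 < T) (hΛ : ∀ c, (Λ c).PosDef)
    (hX : IsProposalProcess T Λ f W X P) {s t : ℝ} (hs : 0 ≤ s) (hst : s < t) (ht : t ≤ T) :
    (transCov T s t Λ).PosSemidef ∧
      HasLaw (fun ω => stack fun c => transResidual T Λ X s t c ω)
        (multivariateGaussian 0 (transCov T s t Λ)) P := by
  have hs' : s ∈ Set.Icc 0 T := ⟨hs, hst.le.trans ht⟩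
  have ht' : t ∈ Set.Icc 0 T := ⟨hs.trans hst.le, ht⟩
  have hcov := fun c c' => hasCrossCov_transResidual hT hΛ hX c c' hs hst ht
  refine (isGaussianSpace_noiseSpace hX).hasLaw_multivariateGaussian ?_ (fun u => ?_) fun p q => ?_
  · refine ((MeasurableEquiv.toLp 2 (ι × Fin d → ℝ)).measurable.comp
      (measurable_pi_lambda _ fun p => ?_)).aemeasurable
    have := measurable_transResidual hX p.1 hs' ht'
    fun_prop
  · have : (fun ω => ⟪u, stack fun c => transResidual T Λ X s t c ω⟫) = ∑ c, fun ω =>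
        ⟪(WithLp.toLp 2 fun i => u (c, i) : Vec d), transResidual T Λ X s t c ω⟫ := by
      ext ω
      simp [PiLp.inner_apply, stack, Fintype.sum_prod_type, Finset.sum_apply]
    rw [this]
    exact Submodule.sum_mem _ fun c _ => (hcov c c).left_mem _
  · exact (hcov p.1 q.1).coord p.2 q.2

lemma hasCondLaw_transition (hT : 0 < T) (hΛ : ∀ c, (Λ c).PosDef)
    (hX : IsProposalProcess T Λ f W X P) {s t : ℝ} (hs : 0 ≤ s) (hst : s < t) (ht : t ≤ T) :
    HasCondLaw (fun ω => stack fun c => X c t ω) (fun ω c => X c s ω)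
      (fun x => multivariateGaussian (stack fun c => transMean T s t Λ x c)
        (transCov T s t Λ)) P := by
  have hs' : s ∈ Set.Icc 0 T := ⟨hs, hst.le.trans ht⟩
  have hstack : Measurable fun x : ι → Vec d => stack x :=
    (MeasurableEquiv.toLp 2 (ι × Fin d → ℝ)).measurable.comp
      (measurable_pi_lambda _ fun p => by fun_prop)
  refine hasCondLaw_of_indepFun (measurable_pi_lambda _ fun c => hX.measurable c s hs').aemeasurable
    (hstack.comp (measurable_pi_lambda _ fun c => (continuous_transMean T s t Λ c).measurable))
    (hasLaw_stack_transResidual hT hΛ hX hs hst ht).2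
    ((indepFun_transResidual hT hΛ hX hs hst ht).comp measurable_id hstack) fun ω => ?_
  ext p
  simp [stack, transResidual]

/-- At `s = t = T` the bridge factor `T - T²/T` is zero, so every pair of noises has covariance `T
Λ_𝒞` and their difference is a degenerate Gaussian. The means also agree: each is the weighted
average of the initial values. -/
lemma ae_eq_terminal (hT : 0 < T) (hΛ : ∀ c, (Λ c).PosDef)
    (hX : IsProposalProcess T Λ f W X P) (c c' : ι) : ∀ᵐ ω ∂P, X c T ω = X c' T ω := by
  have hS := isGaussianSpace_noiseSpace hX
  have hT' : T ∈ Set.Icc 0 T := ⟨hT.le, le_rfl⟩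
  have hcov := fun c c' => hasCrossCov_processNoise hT hΛ hX c c' hT' hT'
  have h := ((hcov c c).sub_left hS (hcov c' c)).sub_right hS
    ((hcov c c').sub_left hS (hcov c' c'))
  have hlaw := (hS.hasLaw_multivariateGaussian (((measurable_processNoise hT.le hX c hT').sub
    (measurable_processNoise hT.le hX c' hT')).aemeasurable) h.left_mem h.coord).2
  have h0 : ∀ c c', noiseCov T Λ c c' T T = T • poolCov Λ := fun c c' => by
    simp [noiseCov, hT.ne']
  simp only [h0, sub_self] at hlaw
  rw [show multivariateGaussian (0 : Vec d) (0 : Matrix (Fin d) (Fin d) ℝ) = Measure.dirac 0 by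
    simp [multivariateGaussian]] at hlaw
  filter_upwards [hlaw.ae_eq_of_dirac] with ω hω
  simpa [processNoise, transMean, sub_eq_zero] using hω

lemma hasCondLaw_terminal (hT : 0 < T) (hΛ : ∀ c, (Λ c).PosDef)
    (hX : IsProposalProcess T Λ f W X P) {s : ℝ} (hs : 0 ≤ s) (hsT : s < T) (c : ι) :
    HasCondLaw (X c T) (fun ω c' => X c' s ω)
      (fun x => multivariateGaussian (weightedAvg Λ x) ((T - s) • poolCov Λ)) P := by
  have hT' : T ∈ Set.Icc 0 T := ⟨hT.le, le_rfl⟩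
  have hTs : T - s ≠ 0 := by linarith
  have hcov := hasCrossCov_transResidual hT hΛ hX c c hs hsT le_rfl
  rw [transCovBlock, if_pos rfl, sub_self, mul_zero, zero_div, zero_smul, zero_add, pow_two,
    mul_div_cancel_right₀ _ hTs] at hcov
  refine hasCondLaw_of_indepFun
    (measurable_pi_lambda _ fun c => hX.measurable c s ⟨hs, hsT.le⟩).aemeasurable
    (continuous_weightedAvg Λ).measurable
    ((isGaussianSpace_noiseSpace hX).hasLaw_multivariateGaussian
      (measurable_transResidual hX c ⟨hs, hsT.le⟩ hT').aemeasurable hcov.left_mem hcov.coord).2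
    ((indepFun_transResidual hT hΛ hX hs hsT le_rfl).comp measurable_id (measurable_pi_apply c))
    fun ω => ?_
  simp [transResidual, transMean, hTs]

end Transition

/-! ### Measurability and bridge laws on path space -/

section PathSpace

variable {d : ℕ} {s t : ℝ}

lemma measurable_eval_path (q : Set.Icc s t) : Measurable fun w : PathSpace d s t => w q :=
  (measurable_pi_apply q).comp (comap_measurable _)

lemma measurable_path_iff {α : Type*} [MeasurableSpace α] {F : α → PathSpace d s t} :
    Measurable F ↔ ∀ q, Measurable fun a => F a q :=
  ⟨fun h q => (measurable_eval_path q).comp h, fun h =>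
    measurable_comap_iff.2 (measurable_pi_lambda _ h)⟩

/-- The path σ-algebra is pulled back from the product σ-algebra, so independence proved for
Gaussian processes indexed by `[s, t]` applies to random paths. -/
lemma indepFun_path_iff {Ω α : Type*} [MeasurableSpace Ω] [MeasurableSpace α] {P : Measure Ω}
    {U : Ω → α} {F : Ω → PathSpace d s t} :
    IndepFun U F P ↔ IndepFun U (fun ω q => F ω q) P := by
  rw [IndepFun_iff_Indep, IndepFun_iff_Indep, pathMeasurableSpace, MeasurableSpace.comap_comp]
  rfl

/-- The mean of the bridge from `x` to `y`. -/
def bridgeMean (s t : ℝ) (x y : Vec d) (q : ℝ) : Vec d :=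
  ((t - q) / (t - s)) • x + ((q - s) / (t - s)) • y

/-- The mean of the bridge from `x` to `y`, as a path. -/
def bridgeMeanPath (s t : ℝ) (x y : Vec d) : PathSpace d s t where
  toFun q := bridgeMean s t x y q
  continuous_toFun := by unfold bridgeMean; fun_prop

/-- A translate of a centered Gaussian process with the bridge covariance has the law of the
bridge. -/
lemma isBrownianBridgeLaw_map {Ω : Type*} [MeasurableSpace Ω] {P : Measure Ω}
    [IsProbabilityMeasure P] {Λ : Matrix (Fin d) (Fin d) ℝ} {B : Ω → PathSpace d s t}
    (hBm : Measurable B) (hB : IsGaussianProcess (fun q ω => B ω q) P)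
    (hB0 : ∀ q, ∫ ω, B ω q ∂P = 0)
    (hcov : ∀ q r : Set.Icc s t, q ≤ r → ∀ i j : Fin d,
      cov[fun ω => B ω q i, fun ω => B ω r j; P] = (q - s) * (t - r) / (t - s) * Λ i j)
    (x y : Vec d) :
    IsBrownianBridgeLaw Λ s t x y (P.map fun ω => bridgeMeanPath s t x y + B ω) := by
  have hm : Measurable fun ω => bridgeMeanPath s t x y + B ω := by
    refine measurable_path_iff.2 fun q => ?_
    exact ((measurable_eval_path q).comp hBm).const_add _
  have hint : ∀ q, Integrable (fun ω => B ω q) P := fun q =>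
    (hB.hasGaussianLaw_eval q).integrable
  have hint' : ∀ q (i : Fin d), Integrable (fun ω => B ω q i) P := fun q i =>
    ((EuclideanSpace.proj i : Vec d →L[ℝ] ℝ).integrable_comp (hint q))
  refine ⟨Measure.isProbabilityMeasure_map hm.aemeasurable, ⟨fun J => ⟨?_⟩⟩, fun q => ?_,
    fun q r hqr i j => ?_⟩
  · have hJ : Measurable fun w : PathSpace d s t => J.restrict fun q => w q :=
      measurable_pi_lambda _ fun q => measurable_eval_path q.1
    have hG := (hB.hasGaussianLaw J).isGaussian_map
    have hJB : Measurable fun ω => J.restrict fun q => B ω q := hJ.comp hBm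
    rw [Measure.map_map hJ hm]
    have heq : ((fun w : PathSpace d s t => J.restrict fun q => w q) ∘
        fun ω => bridgeMeanPath s t x y + B ω) =
        (fun z => (J.restrict fun q => bridgeMeanPath s t x y q) + z) ∘
          fun ω => J.restrict fun q => B ω q := rfl
    rw [heq, ← Measure.map_map (measurable_const_add _) hJB]
    infer_instance
  · rw [integral_map hm.aemeasurable (measurable_eval_path q).aestronglyMeasurable]
    simp only [ContinuousMap.add_apply]
    rw [integral_add (integrable_const _) (hint q), hB0, add_zero, integral_const]
    simp [bridgeMeanPath, bridgeMean]
  · have hcoord : ∀ (q : Set.Icc s t) (i : Fin d), Measurable fun w : PathSpace d s t => w q i :=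
      fun q i => (by fun_prop : Measurable fun v : Vec d => v i).comp (measurable_eval_path q)
    rw [covariance_map_fun (hcoord q i).aestronglyMeasurable (hcoord r j).aestronglyMeasurable
      hm.aemeasurable]
    simp only [ContinuousMap.add_apply, PiLp.add_apply]
    rw [covariance_const_add_left (hint' q i), covariance_const_add_right (hint' r j),
      hcov q r hqr]

end PathSpace

/-! ### Brownian bridges between two times -/

section Bridge

variable {Ω : Type*}
  {d : ℕ} {ι : Type*} [Fintype ι]
  {T : ℝ} {Λ : ι → Matrix (Fin d) (Fin d) ℝ} {f : ι → Vec d → ℝ}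
  {W : ι → ℝ≥0 → Ω → Vec d} {X : ι → ℝ → Ω → Vec d}

/-- The deviation of the path of `X⁽ᶜ⁾` on `[s, t]` from the interpolation of its end points. -/
def bridgeResidual (X : ι → ℝ → Ω → Vec d) (s t : ℝ) (c : ι) (q : ℝ) (ω : Ω) : Vec d :=
  X c q ω - bridgeMean s t (X c s ω) (X c t ω) q

/-- The mean given the initial values is affine in time, and interpolation reproduces affine
functions, so the initial values cancel. -/
lemma bridgeResidual_eq (hT : 0 < T) {s t : ℝ} (hst : s < t) (c : ι) (q : ℝ) (ω : Ω) :
    bridgeResidual X s t c q ω = processNoise T Λ X c q ω -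
      bridgeMean s t (processNoise T Λ X c s ω) (processNoise T Λ X c t ω) q := by
  have hts : t - s ≠ 0 := by linarith
  have hT0 := hT.ne'
  unfold bridgeResidual processNoise bridgeMean transMean
  simp only [sub_zero]
  match_scalars <;> field_simp <;> ring

variable [mΩ : MeasurableSpace Ω] {P : Measure Ω}

lemma measurable_bridgeResidual (hX : IsProposalProcess T Λ f W X P) (c : ι) {q s t : ℝ}
    (hs : s ∈ Set.Icc 0 T) (ht : t ∈ Set.Icc 0 T) (hq : q ∈ Set.Icc 0 T) :
    Measurable (bridgeResidual X s t c q) := by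
  have h1 := hX.measurable c s hs
  have h2 := hX.measurable c t ht
  have h3 := hX.measurable c q hq
  unfold bridgeResidual bridgeMean
  fun_prop

variable [IsProbabilityMeasure P] [DecidableEq ι] [Nonempty ι]

/-- For a single component the noise covariance is `min(q,r) Λ_c - (qr/T)(Λ_c - Λ_𝒞)`. The second
term is linear in `q` and is removed by interpolation, so every trace of `T` and of the other
components disappears. -/
lemma hasCrossCov_bridgeResidual_processNoise (hT : 0 < T) (hΛ : ∀ c, (Λ c).PosDef)
    (hX : IsProposalProcess T Λ f W X P) (c : ι) {q r s t : ℝ} (hs : s ∈ Set.Icc 0 T)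
    (ht : t ∈ Set.Icc 0 T) (hst : s < t) (hq : q ∈ Set.Icc 0 T) (hr : r ∈ Set.Icc 0 T) :
    HasCrossCov (noiseSpace W P) P (bridgeResidual X s t c q) (processNoise T Λ X c r)
      ((min q r - ((t - q) / (t - s) * min s r + (q - s) / (t - s) * min t r)) • Λ c) := by
  have hS := isGaussianSpace_noiseSpace hX
  have hts : t - s ≠ 0 := by linarith
  rw [funext (bridgeResidual_eq (X := X) (Λ := Λ) hT hst c q)]
  convert! (hasCrossCov_processNoise hT hΛ hX c c hq hr).sub_left hS
    (((hasCrossCov_processNoise hT hΛ hX c c hs hr).smul_left ((t - q) / (t - s))).add_left hS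
      ((hasCrossCov_processNoise hT hΛ hX c c ht hr).smul_left ((q - s) / (t - s)))) using 1
  simp only [noiseCov, residualCov, if_true]
  match_scalars <;> field_simp <;> ring

/-- On `[s, t]` the function `q ↦ min(q, s)` is constant, so its interpolation error is zero. At the
right end point, `q ↦ min(q, t)` is the identity, which is affine as well. -/
lemma hasCrossCov_bridgeResidual_left_zero (hT : 0 < T) (hΛ : ∀ c, (Λ c).PosDef)
    (hX : IsProposalProcess T Λ f W X P) (c : ι) {q s t : ℝ} (hs : 0 ≤ s) (ht : t ≤ T)
    (hst : s < t) (hq : q ∈ Set.Icc s t) :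
    HasCrossCov (noiseSpace W P) P (bridgeResidual X s t c q) (processNoise T Λ X c s) 0 := by
  have hts : t - s ≠ 0 := by linarith
  have h := hasCrossCov_bridgeResidual_processNoise hT hΛ hX c (r := s) ⟨hs, hst.le.trans ht⟩
    ⟨hs.trans hst.le, ht⟩ hst ⟨hs.trans hq.1, hq.2.trans ht⟩ ⟨hs, hst.le.trans ht⟩
  rw [min_eq_right hq.1, min_self, min_eq_right hst.le] at h
  convert! h using 1
  match_scalars
  field_simp
  ring

lemma hasCrossCov_bridgeResidual_right_zero (hT : 0 < T) (hΛ : ∀ c, (Λ c).PosDef)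
    (hX : IsProposalProcess T Λ f W X P) (c : ι) {q s t : ℝ} (hs : 0 ≤ s) (ht : t ≤ T)
    (hst : s < t) (hq : q ∈ Set.Icc s t) :
    HasCrossCov (noiseSpace W P) P (bridgeResidual X s t c q) (processNoise T Λ X c t) 0 := by
  have hts : t - s ≠ 0 := by linarith
  have h := hasCrossCov_bridgeResidual_processNoise hT hΛ hX c (r := t) ⟨hs, hst.le.trans ht⟩
    ⟨hs.trans hst.le, ht⟩ hst ⟨hs.trans hq.1, hq.2.trans ht⟩ ⟨hs.trans hst.le, ht⟩
  rw [min_eq_left hq.2, min_self, min_eq_left hst.le] at h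
  convert! h using 1
  match_scalars
  field_simp
  ring

lemma hasCrossCov_bridgeResidual (hT : 0 < T) (hΛ : ∀ c, (Λ c).PosDef)
    (hX : IsProposalProcess T Λ f W X P) (c : ι) {q r s t : ℝ} (hs : 0 ≤ s) (ht : t ≤ T)
    (hst : s < t) (hq : q ∈ Set.Icc s t) (hr : r ∈ Set.Icc s t) (hqr : q ≤ r) :
    HasCrossCov (noiseSpace W P) P (bridgeResidual X s t c q) (bridgeResidual X s t c r)
      (((q - s) * (t - r) / (t - s)) • Λ c) := by
  have hts : t - s ≠ 0 := by linarith
  have hS := isGaussianSpace_noiseSpace hX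
  have h := (hasCrossCov_bridgeResidual_processNoise hT hΛ hX c (r := r) ⟨hs, hst.le.trans ht⟩
    ⟨hs.trans hst.le, ht⟩ hst ⟨hs.trans hq.1, hq.2.trans ht⟩
    ⟨hs.trans hr.1, hr.2.trans ht⟩).sub_right hS
    (((hasCrossCov_bridgeResidual_left_zero hT hΛ hX c hs ht hst hq).smul_right
      ((t - r) / (t - s))).add_right hS
      ((hasCrossCov_bridgeResidual_right_zero hT hΛ hX c hs ht hst hq).smul_right
        ((r - s) / (t - s))))
  rw [min_eq_left hqr, min_eq_left hr.1, min_eq_right hr.2] at h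
  rw [funext (bridgeResidual_eq (X := X) (Λ := Λ) hT hst c r)]
  convert! h using 1
  match_scalars
  field_simp
  ring

lemma indepFun_bridgeResidual (hT : 0 < T) (hΛ : ∀ c, (Λ c).PosDef)
    (hX : IsProposalProcess T Λ f W X P) (c : ι) {s t : ℝ} (hs : 0 ≤ s) (ht : t ≤ T)
    (hst : s < t) :
    IndepFun (fun ω => (X c s ω, X c t ω))
      (fun ω (q : Set.Icc s t) => bridgeResidual X s t c q ω) P := by
  have hs' : s ∈ Set.Icc 0 T := ⟨hs, hst.le.trans ht⟩
  have ht' : t ∈ Set.Icc 0 T := ⟨hs.trans hst.le, ht⟩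
  -- The two end points are indexed by `Bool`, so that the noise at both times forms one countable
  -- family.
  have hend : ∀ b : Bool, (bif b then t else s) ∈ Set.Icc 0 T := by
    rintro (_ | _)
    exacts [hs', ht']
  have h0 : ∀ (b : Bool) (q : Set.Icc s t), HasCrossCov (noiseSpace W P) P
      (bridgeResidual X s t c q) (processNoise T Λ X c (bif b then t else s)) 0 := by
    rintro (_ | _) q
    exacts [hasCrossCov_bridgeResidual_left_zero hT hΛ hX c hs ht hst q.2,
      hasCrossCov_bridgeResidual_right_zero hT hΛ hX c hs ht hst q.2]
  have hsI : s ∈ Set.Icc s t := ⟨le_rfl, hst.le⟩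
  have h := indepFun_prodMk_of_hasCrossCov_zero (isGaussianSpace_noiseSpace hX)
    (measurable_pi_lambda _ fun c => hX.measurable c 0 ⟨le_rfl, hT.le⟩) (indep_init_noise hX)
    (Y := fun b : Bool => processNoise T Λ X c (bif b then t else s))
    (Z := fun q : Set.Icc s t => bridgeResidual X s t c q)
    (fun b => measurable_processNoise hT.le hX c (hend b))
    (fun q => measurable_bridgeResidual hX c hs' ht' ⟨hs.trans q.2.1, q.2.2.trans ht⟩)
    (fun b => (h0 b ⟨s, hsI⟩).right_mem) (fun q => (h0 true q).left_mem)
    fun b q => by simpa using (h0 b q).symm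
  have hφ : Measurable fun p : (ι → Vec d) × (Bool → Vec d) =>
      (transMean T 0 s Λ p.1 c + p.2 false, transMean T 0 t Λ p.1 c + p.2 true) :=
    (((continuous_transMean T 0 s Λ c).measurable.comp measurable_fst).add (by fun_prop)).prodMk
      (((continuous_transMean T 0 t Λ c).measurable.comp measurable_fst).add (by fun_prop))
  convert! h.comp hφ measurable_id using 1
  ext1 ω
  simp [processNoise]

lemma exists_bridge_hasCondDistrib (hT : 0 < T) (hΛ : ∀ c, (Λ c).PosDef)
    (hX : IsProposalProcess T Λ f W X P) (c : ι) {s t : ℝ} (hs : 0 ≤ s) (hst : s < t)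
    (ht : t ≤ T) :
    ∃ κ : Kernel (Vec d × Vec d) (PathSpace d s t),
      (∀ x y, IsBrownianBridgeLaw (Λ c) s t x y (κ (x, y))) ∧
      HasCondDistrib
        (fun ω => restrictPath (fun q => X c q ω) (hX.continuousOn c ω) hs ht)
        (fun ω => (X c s ω, X c t ω)) κ P := by
  have hs' : s ∈ Set.Icc 0 T := ⟨hs, hst.le.trans ht⟩
  have ht' : t ∈ Set.Icc 0 T := ⟨hs.trans hst.le, ht⟩
  have hS := isGaussianSpace_noiseSpace hX
  let B : Ω → PathSpace d s t := fun ω =>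
    restrictPath (fun q => X c q ω) (hX.continuousOn c ω) hs ht -
      bridgeMeanPath s t (X c s ω) (X c t ω)
  have hBq : ∀ ω (q : Set.Icc s t), B ω q = bridgeResidual X s t c q ω := fun ω q => rfl
  have hcov := fun (q r : Set.Icc s t) (hqr : q ≤ r) =>
    hasCrossCov_bridgeResidual hT hΛ hX c hs ht hst q.2 r.2 hqr
  have hBqm : ∀ q : Set.Icc s t, Measurable fun ω => B ω q := fun q =>
    measurable_bridgeResidual hX c hs' ht' ⟨hs.trans q.2.1, q.2.2.trans ht⟩
  have hBm : Measurable B := measurable_path_iff.2 hBqm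
  have hBG : IsGaussianProcess (fun (q : Set.Icc s t) ω => B ω q) P :=
    hS.isGaussianProcess fun q u => (hcov q q le_rfl).left_mem u
  have hB0 : ∀ q : Set.Icc s t, ∫ ω, B ω q ∂P = 0 := fun q => by
    rw [(hS.hasLaw_multivariateGaussian (hBqm q).aemeasurable (hcov q q le_rfl).left_mem
      (hcov q q le_rfl).coord).2.integral_eq]
    exact integral_id_multivariateGaussian
  have hind : IndepFun (fun ω => (X c s ω, X c t ω)) B P :=
    indepFun_path_iff.2 (indepFun_bridgeResidual hT hΛ hX c hs ht hst)
  have hg : Measurable (Function.uncurry fun (p : Vec d × Vec d) (b : PathSpace d s t) =>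
      bridgeMeanPath s t p.1 p.2 + b) := by
    refine measurable_path_iff.2 fun q => ?_
    have := measurable_eval_path (d := d) q
    change Measurable fun a : (Vec d × Vec d) × PathSpace d s t =>
      bridgeMean s t a.1.1 a.1.2 q + a.2 q
    refine Measurable.add ?_ (this.comp measurable_snd)
    unfold bridgeMean
    fun_prop
  obtain ⟨κ, hκ, h⟩ := exists_hasCondDistrib_of_indepFun
    (Y := fun ω => restrictPath (fun q => X c q ω) (hX.continuousOn c ω) hs ht)
    ((hX.measurable c s hs').prodMk (hX.measurable c t ht')).aemeasurable hBm.aemeasurable hind hg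
    (ae_of_all _ fun ω => (add_sub_cancel _ _).symm)
  refine ⟨κ, fun x y => ?_, h⟩
  rw [hκ, Measure.map_map (hg.of_uncurry_left) hBm]
  exact isBrownianBridgeLaw_map hBm hBG hB0 (fun q r hqr i j => (hcov q r hqr).coord i j) x y

lemma hasCondLaw_bridge (hT : 0 < T) (hΛ : ∀ c, (Λ c).PosDef)
    (hX : IsProposalProcess T Λ f W X P) (c : ι) {q s t : ℝ} (hs : 0 ≤ s) (hst : s < t)
    (ht : t ≤ T) (hq : q ∈ Set.Icc s t) :
    HasCondLaw (X c q) (fun ω => (X c s ω, X c t ω))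
      (fun z => multivariateGaussian
        ((t - s)⁻¹ • ((t - q) • z.1 + (q - s) • z.2))
        (((t - q) * (q - s) / (t - s)) • Λ c)) P := by
  have hs' : s ∈ Set.Icc 0 T := ⟨hs, hst.le.trans ht⟩
  have ht' : t ∈ Set.Icc 0 T := ⟨hs.trans hst.le, ht⟩
  have hcov := hasCrossCov_bridgeResidual hT hΛ hX c hs ht hst hq hq le_rfl
  rw [mul_comm (q - s)] at hcov
  refine hasCondLaw_of_indepFun
    ((hX.measurable c s hs').prodMk (hX.measurable c t ht')).aemeasurable (by fun_prop)
    ((isGaussianSpace_noiseSpace hX).hasLaw_multivariateGaussian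
      (measurable_bridgeResidual hX c hs' ht' ⟨hs.trans hq.1, hq.2.trans ht⟩).aemeasurable
      hcov.left_mem hcov.coord).2
    ((indepFun_bridgeResidual hT hΛ hX c hs ht hst).comp measurable_id
      (measurable_pi_apply (⟨q, hq⟩ : Set.Icc s t))) fun ω => ?_
  simp only [bridgeResidual, bridgeMean]
  module

end Bridge

end

theorem proposition2 {Ω : Type*} [MeasurableSpace Ω] (P : Measure Ω) [IsProbabilityMeasure P]
    {d : ℕ} {ι : Type*} [Fintype ι] [DecidableEq ι] [Nonempty ι]
    (T : ℝ) (hT : 0 < T)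
    (Λ : ι → Matrix (Fin d) (Fin d) ℝ) (hΛ : ∀ c, (Λ c).PosDef)
    (f : ι → Vec d → ℝ) (hf_meas : ∀ c, Measurable (f c)) (hf_nonneg : ∀ c x, 0 ≤ f c x)
    (W : ι → ℝ≥0 → Ω → Vec d) (X : ι → ℝ → Ω → Vec d)
    (hX : IsProposalProcess T Λ f W X P) :
    (∀ s t : ℝ, 0 ≤ s → s < t → t < T →
      (transCov T s t Λ).PosSemidef ∧
      HasCondLaw (fun ω => stack fun c => X c t ω) (fun ω c => X c s ω)
        (fun x => multivariateGaussian (stack fun c => transMean T s t Λ x c)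
          (transCov T s t Λ)) P) ∧
    (∀ᵐ ω ∂P, ∀ c c', X c T ω = X c' T ω) ∧
    (∀ s : ℝ, 0 ≤ s → s < T → ∀ c,
      HasCondLaw (X c T) (fun ω c' => X c' s ω)
        (fun x => multivariateGaussian (weightedAvg Λ x) ((T - s) • poolCov Λ)) P) ∧
    (∀ c, ∀ s t : ℝ, ∀ hs : 0 ≤ s, s < t → ∀ ht : t ≤ T,
      (∃ κ : Kernel (Vec d × Vec d) (PathSpace d s t),
        (∀ x y, IsBrownianBridgeLaw (Λ c) s t x y (κ (x, y))) ∧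
        HasCondDistrib
          (fun ω => restrictPath (fun q => X c q ω) (hX.continuousOn c ω) hs ht)
          (fun ω => (X c s ω, X c t ω)) κ P) ∧
      ∀ q : ℝ, s ≤ q → q ≤ t →
        HasCondLaw (X c q) (fun ω => (X c s ω, X c t ω))
          (fun z => multivariateGaussian
            ((t - s)⁻¹ • ((t - q) • z.1 + (q - s) • z.2))
            (((t - q) * (q - s) / (t - s)) • Λ c)) P) := by
  refine ⟨fun s t hs hst ht => ⟨(hasLaw_stack_transResidual hT hΛ hX hs hst ht.le).1,
      hasCondLaw_transition hT hΛ hX hs hst ht.le⟩, ?_,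
    fun s hs hsT c => hasCondLaw_terminal hT hΛ hX hs hsT c, fun c s t hs hst ht =>
      ⟨exists_bridge_hasCondDistrib hT hΛ hX c hs hst ht, fun q hsq hqt =>
        hasCondLaw_bridge hT hΛ hX c hs hst ht ⟨hsq, hqt⟩⟩⟩
  simp_rw [ae_all_iff]
  exact fun c c' => ae_eq_terminal hT hΛ hX c c'
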